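/- Lemma 5 (mm-wave SINR coverage). The access points (APs) form a homogeneous Poisson point process of intensity $\lambda>0$ on $\mathbb R^2$; the typical user is at the origin. An AP at $z$ is in visibility state $v=L$ (LOS) if $\|z\|\le d$ and in state $v=N$ (NLOS) otherwise. Its average mm-wave received power is $K_mP_m\|z\|^{-\alpha_v}$, with $K_m,P_m,\alpha_L,\alpha_N>0$, and its coordinate in the (one-dimensional) path-loss process $\phi'_{vm}$ is $\xi=\|z\|^{\alpha_v}/(K_mP_m)$. The user is served by the AP with the strongest average received power. The links have i.i.d. Rayleigh fading (exponential powers $h_i$ of mean $1$). The antenna gains $G_i$ of the interfering links are i.i.d. and take values $a_k\ge 0$ with probabilities $b_k$, $k=1,\dots,4$; fading, gains and AP locations are independent. The serving link is aligned and has the maximal gain $G_0=\max_k a_k>0$. With noise power $\sigma_{N,m}^2\ge 0$ and serving AP $i_0$, $$\mathrm{SINR}=\frac{G_0\,h_{i_0}\,\xi_{i_0}^{-1}}{\sigma_{N,m}^2+\sum_{i\ne i_0}G_i\,h_i\,\xi_i^{-1}} .$$ Let $\Lambda'_{vm}$ be the image, under the path-loss map, of Lebesgue measure times $\lambda$ on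 the region where the state is $v$. Then: (i) $\Lambda'_{vm}$ is the intensity measure of $\phi'_{vm}$, that is, $\Lambda'_{vm}(A)=\mathbb E\,\#(\phi'_{vm}\cap A)$ for all Borel sets $A$. (ii) For every threshold $\gamma>0$, the conditional probability of $\{\mathrm{SINR}>\gamma\}$ given that the serving AP has path-loss coordinate $x$ and visibility state $v$ is (almost surely) $$\exp\Big(-\frac{\gamma\,x\,\sigma_{N,m}^2}{G_0}-B_1(\gamma,x)-B_2(\gamma,x)\Big),$$ where, with $v'$ the visibility state other than $v$, $$B_1(\gamma,x)=\sum_{k=1}^4 b_k\int_x^\infty\frac{\frac{a_k}{G_0}\gamma x}{y+\frac{a_k}{G_0}\gamma x}\,\Lambda'_{vm}(dy),\qquad B_2(\gamma,x)=\sum_{k=1}^4 b_k\int_x^\infty\frac{\frac{a_k}{G_0}\gamma x}{y+\frac{a_k}{G_0}\gamma x}\,\Lambda'_{v'm}(dy).$$ The integrals may be $+\infty$ (when the interference is almost surely infinite), and $e^{-\infty}=0$. -/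

import Mathlib

open MeasureTheory ProbabilityTheory Set
open scoped ENNReal

namespace MmWave

/-- The Euclidean plane, in which the access points (APs) live; the typical user is at `0`. -/
abbrev Plane : Type := EuclideanSpace ℝ (Fin 2)

/-- Visibility state of an AP: line of sight or non line of sight. -/
inductive Visibility : Type
  | los
  | nlos

instance : MeasurableSpace Visibility := ⊤

/-- The opposite visibility state. -/
def Visibility.other : Visibility → Visibility
  | .los => .nlos
  | .nlos => .los

section PointProcess

variable {Ω E : Type*} [MeasurableSpace Ω] [MeasurableSpace E]

/-- Number of points of the configuration `(X i ω)ᵢ` that lie in `B`. -/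
noncomputable def count (X : ℕ → Ω → E) (B : Set E) (ω : Ω) : ℕ∞ :=
  {i : ℕ | X i ω ∈ B}.encard

/-- `X` enumerates (in some measurable way) the points of a Poisson point process with intensity
measure `Λ`: the number of points in a set `B` with `Λ B < ∞` is Poisson distributed with mean
`Λ B`, and the numbers of points in pairwise disjoint sets are independent. -/
structure IsPoissonProcess (X : ℕ → Ω → E) (Λ : Measure E) (μ : Measure Ω) : Prop where
  measurable : ∀ i, Measurable (X i)
  count_law : ∀ B : Set E, MeasurableSet B → Λ B ≠ ∞ →
    HasLaw (count X B) ((poissonMeasure (Λ B).toNNReal).map (Nat.cast : ℕ → ℕ∞)) μ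
  count_indep : ∀ (n : ℕ) (B : Fin n → Set E), (∀ j, MeasurableSet (B j)) →
    Pairwise (fun j k => Disjoint (B j) (B k)) → iIndepFun (fun j => count X (B j)) μ

end PointProcess

section Network

/-- Visibility state of an AP at `z`, for a LOS ball of radius `d`: LOS iff `‖z‖ ≤ d`. -/
noncomputable def visibility (d : ℝ) (z : Plane) : Visibility :=
  open Classical in if ‖z‖ ≤ d then .los else .nlos

/-- Average received power `K P ‖z‖ ^ (-α_v)` from an AP at `z` in visibility state `v`. -/
noncomputable def rxPower (d K P : ℝ) (α : Visibility → ℝ) (z : Plane) : ℝ :=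
  K * P * ‖z‖ ^ (-α (visibility d z))

/-- Path-loss coordinate `ξ = ‖z‖ ^ α_v / (K P)` of an AP at `z` in visibility state `v`. -/
noncomputable def pathLoss (d K P : ℝ) (α : Visibility → ℝ) (z : Plane) : ℝ :=
  ‖z‖ ^ α (visibility d z) / (K * P)

/-- The measure `Λ'_v` on the line: image, under the path-loss map, of the intensity measure of
the APs in state `v` (density `lam` on the LOS ball for `v = los`, on its complement for
`v = nlos`). -/
noncomputable def pathLossIntensity (lam d K P : ℝ) (α : Visibility → ℝ) (v : Visibility) :
    Measure ℝ :=
  ((ENNReal.ofReal lam • (volume : Measure Plane)).restrict {z | visibility d z = v}).map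
    (pathLoss d K P α)

variable {Ω : Type*}

/-- Index of the serving AP: the one with the strongest average received power (the least index
in case of ties, which have probability zero; `0` if there is no maximum). -/
noncomputable def serving (d K P : ℝ) (α : Visibility → ℝ) (X : ℕ → Ω → Plane) (ω : Ω) : ℕ :=
  sInf {i | ∀ j, rxPower d K P α (X j ω) ≤ rxPower d K P α (X i ω)}

/-- Path-loss coordinate of the serving AP. -/
noncomputable def servingPathLoss (d K P : ℝ) (α : Visibility → ℝ) (X : ℕ → Ω → Plane)
    (ω : Ω) : ℝ :=
  pathLoss d K P α (X (serving d K P α X ω) ω)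

/-- Visibility state of the serving AP. -/
noncomputable def servingVisibility (d K P : ℝ) (α : Visibility → ℝ) (X : ℕ → Ω → Plane)
    (ω : Ω) : Visibility :=
  visibility d (X (serving d K P α X ω) ω)

/-- Total interference: the sum over all non-serving APs of (fading) × (antenna gain) ×
(average received power); it may be infinite. -/
noncomputable def interference (d K P : ℝ) (α : Visibility → ℝ) (X : ℕ → Ω → Plane)
    (h G : ℕ → Ω → ℝ) (ω : Ω) : ℝ≥0∞ :=
  ∑' i, if i = serving d K P α X ω then 0
    else ENNReal.ofReal (h i ω * G i ω * rxPower d K P α (X i ω))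

/-- SINR of the typical user; the serving link is aligned and has the maximal gain `G0`. -/
noncomputable def sinr (d K P : ℝ) (α : Visibility → ℝ) (G0 σ2 : ℝ) (X : ℕ → Ω → Plane)
    (h G : ℕ → Ω → ℝ) (ω : Ω) : ℝ≥0∞ :=
  ENNReal.ofReal (G0 * h (serving d K P α X ω) ω * rxPower d K P α (X (serving d K P α X ω) ω)) /
    (ENNReal.ofReal σ2 + interference d K P α X h G ω)

end Network

/-- `e^{-t}` for `t ∈ [0, ∞]`, with `e^{-∞} = 0`. -/
noncomputable def expNeg (t : ℝ≥0∞) : ℝ :=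
  open Classical in if t = ∞ then 0 else Real.exp (-t.toReal)

/-- `∑ₖ bₖ ∫_x^∞ (cₖ γ x) / (y + cₖ γ x) Λ(dy)` with the relative gains `cₖ = aₖ / G0`. -/
noncomputable def gainIntegral (a b : Fin 4 → ℝ) (G0 γ : ℝ) (Λ : Measure ℝ) (x : ℝ) : ℝ≥0∞ :=
  ∑ k, ENNReal.ofReal (b k) *
    ∫⁻ y in Ioi x, ENNReal.ofReal ((a k / G0 * γ * x) / (y + a k / G0 * γ * x)) ∂Λ

end MmWave

open MmWave

/-! Fix the AP locations, let `x` be the serving level and `I` the interference. Rayleigh fading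
turns coverage into a tail event of an exponential variable, `h i₀ > s (σ² + I)` with `s = γ x /
G0`, so given `I` its probability is `e^{-s (σ² + I)}`. Averaging over the independent marks gives
one factor per interferer. Writing the factor at level `y` as `e^{-levelLoss x y}`, the coverage
probability becomes the exponential of minus a noise term minus a sum over the points of level above
`x` (`measure_coverage_of_regular`).

It remains to average over the locations, given the serving point. That point has the least level,
and the key fact is that the points beyond it still behave like a Poisson process with intensity
`Λ`. In terms of Laplace functionals this is `lintegral_nearest`. It rests on the formula `E e^{-Σ
g} = e^{-∫ (1 - e^{-g}) dΛ}`, with independence from the counts in sets off the support of `g`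
(`laplace`). Conditioning on the null event of an exact level is avoided by cutting the level axis
into cells of width `1 / (n + 1)`: on the event that a cell holds the only point at or below its
right end, `x` is replaced by that deterministic right end, and disjoint regions are independent.
The limit `n → ∞` uses distinct, positive, locally finite levels (`ae_isRegularAt`) and continuity
of the loss in `x`.

Finally, `1 - e^{-levelLoss}` is exactly the weighted sum of fractions in the statement, and its
integrals over the LOS and NLOS regions are `B₁` and `B₂` in one order or the other
(`gainIntegral_add`). Working in `[0, ∞]` with `eexp` removes any separate case for infinite
interference. -/

open Filter Topology
open scoped NNReal

namespace MmWave

/-! ### The map `t ↦ e^{-t}` on `[0, ∞]`. -/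

section NegativeExponential

/-- `e^{-t}` as an extended nonnegative real, for `t ∈ [0, ∞]`. -/
noncomputable def eexp (t : ℝ≥0∞) : ℝ≥0∞ := EReal.exp (-(t : EReal))

@[simp] lemma eexp_zero : eexp 0 = 1 := by simp [eexp]

@[simp] lemma eexp_top : eexp ∞ = 0 := by simp [eexp]

lemma eexp_ofReal {x : ℝ} (hx : 0 ≤ x) : eexp (ENNReal.ofReal x) = ENNReal.ofReal (Real.exp (-x)) := by
  rw [eexp, EReal.coe_ennreal_ofReal, max_eq_left hx, ← EReal.coe_neg, EReal.exp_coe]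

lemma eexp_add (s t : ℝ≥0∞) : eexp (s + t) = eexp s * eexp t := by
  rw [eexp, EReal.coe_ennreal_add, EReal.neg_add (by simp) (by simp), sub_eq_add_neg, EReal.exp_add]
  rfl

lemma continuous_eexp : Continuous eexp :=
  ENNReal.continuous_exp.comp (continuous_neg.comp continuous_coe_ennreal_ereal)

@[fun_prop]
lemma measurable_eexp : Measurable eexp := continuous_eexp.measurable

lemma eexp_antitone : Antitone eexp := fun s t hst => by
  simpa [eexp] using hst

lemma eexp_le_one (t : ℝ≥0∞) : eexp t ≤ 1 := by
  simpa using eexp_antitone (zero_le : 0 ≤ t)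

lemma eexp_sum {ι : Type*} (s : Finset ι) (f : ι → ℝ≥0∞) :
    eexp (∑ i ∈ s, f i) = ∏ i ∈ s, eexp (f i) := by
  classical
  induction s using Finset.induction_on with
  | empty => simp
  | insert i s hi ih => rw [Finset.sum_insert hi, Finset.prod_insert hi, eexp_add, ih]

lemma eexp_nsmul (n : ℕ) (t : ℝ≥0∞) : eexp (n * t) = eexp t ^ n := by
  simpa using eexp_sum (Finset.range n) (fun _ => t)

lemma ofReal_expNeg (t : ℝ≥0∞) : ENNReal.ofReal (expNeg t) = eexp t := by
  rw [expNeg]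
  split_ifs with ht
  · simp [ht]
  · rw [← eexp_ofReal ENNReal.toReal_nonneg, ENNReal.ofReal_toReal ht]

lemma expNeg_eq (t : ℝ≥0∞) : expNeg t = (eexp t).toReal := by
  rw [← ofReal_expNeg, ENNReal.toReal_ofReal]
  rw [expNeg]
  split_ifs
  · exact le_rfl
  · exact (Real.exp_pos _).le

end NegativeExponential

/-! ### Moments and tails of the Poisson law. -/

section Poisson

lemma lintegral_poissonMeasure (r : ℝ≥0) (u : ℕ → ℝ≥0∞) :
    ∫⁻ n, u n ∂(poissonMeasure r) =
      ∑' n : ℕ, ENNReal.ofReal (Real.exp (-r) * r ^ n / n.factorial) * u n := by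
  simp [poissonMeasure, lintegral_sum_measure, lintegral_smul_measure]

/-- Shift the index: `n` times the mass at `n` is `r` times the mass at `n - 1`, and the masses sum
to one. -/
lemma lintegral_poissonMeasure_natCast (r : ℝ≥0) :
    ∫⁻ n : ℕ, (n : ℝ≥0∞) ∂(poissonMeasure r) = r := by
  rw [lintegral_poissonMeasure, tsum_eq_zero_add' ENNReal.summable]
  have : ∀ n : ℕ, ENNReal.ofReal (Real.exp (-r) * r ^ (n + 1) / (n + 1).factorial) * ((n + 1 : ℕ) : ℝ≥0∞)
      = r * ENNReal.ofReal (Real.exp (-r) * r ^ n / n.factorial) := fun n => by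
    rw [← ENNReal.ofReal_natCast, ← ENNReal.ofReal_mul (by positivity), ← ENNReal.ofReal_coe_nnreal,
      ← ENNReal.ofReal_mul (by positivity), Nat.factorial_succ]
    congr 1
    push_cast
    field_simp
    ring
  simp_rw [this]
  rw [ENNReal.tsum_mul_left]
  have h1 := lintegral_poissonMeasure r (fun _ => 1)
  simp only [lintegral_const, measure_univ, mul_one] at h1
  simp [← h1]

lemma lintegral_poissonMeasure_pow (r : ℝ≥0) {q : ℝ} (hq : 0 ≤ q) (hq1 : q ≤ 1) :
    ∫⁻ n : ℕ, ENNReal.ofReal q ^ n ∂(poissonMeasure r) = eexp (r * ENNReal.ofReal (1 - q)) := by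
  rw [lintegral_poissonMeasure]
  have h0 : ∀ n : ℕ, ENNReal.ofReal (Real.exp (-r) * r ^ n / n.factorial) * ENNReal.ofReal q ^ n
      = ENNReal.ofReal (Real.exp (-r) * ((r * q) ^ n / n.factorial)) := fun n => by
    rw [← ENNReal.ofReal_pow hq, ← ENNReal.ofReal_mul (by positivity)]
    congr 1
    rw [mul_pow]; ring
  have hs := (NormedSpace.expSeries_div_hasSum_exp ((r : ℝ) * q)).mul_left (Real.exp (-r))
  simp_rw [h0]
  rw [← ENNReal.ofReal_tsum_of_nonneg (fun n => by positivity) hs.summable, hs.tsum_eq,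
    ← Real.exp_eq_exp_ℝ, ← Real.exp_add, ← ENNReal.ofReal_coe_nnreal,
    ← ENNReal.ofReal_mul (p := (r : ℝ)) r.2, eexp_ofReal (mul_nonneg r.coe_nonneg (by linarith))]
  congr 2; ring

/-- From `e^{-r} ≥ 1 - r` follows `1 - e^{-r} (1 + r) ≤ 1 - (1 - r) (1 + r) = r²`. The quadratic
order is what makes coincidences of points negligible on fine grids. -/
lemma poissonMeasure_two_le (r : ℝ≥0) : poissonMeasure r {n | 2 ≤ n} ≤ (r : ℝ≥0∞) ^ 2 := by
  have h1 : {n : ℕ | 2 ≤ n} = ({0, 1} : Set ℕ)ᶜ := by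
    ext n; simp; omega
  rw [h1, prob_compl_eq_one_sub (by measurability), Set.insert_eq, measure_union (by simp) (by measurability),
    poissonMeasure_singleton, poissonMeasure_singleton, ← ENNReal.ofReal_add (by positivity) (by positivity),
    ← ENNReal.ofReal_one, ← ENNReal.ofReal_sub _ (by positivity), ← ENNReal.ofReal_coe_nnreal,
    ← ENNReal.ofReal_pow (by positivity)]
  refine ENNReal.ofReal_le_ofReal ?_
  simp only [pow_zero, mul_one, Nat.factorial_zero, Nat.cast_one, div_one, pow_one, Nat.factorial_one]
  nlinarith [Real.add_one_le_exp (-(r : ℝ)), r.2]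

end Poisson

/-! ### Counts of a Poisson process and its mean measure. -/

section Count

variable {Ω E : Type*} [MeasurableSpace Ω] [MeasurableSpace E] {X : ℕ → Ω → E} {Λ : Measure E}
  {μ : Measure Ω}

/-- Number of points in `B`, as an extended nonnegative real. -/
noncomputable def ecount (X : ℕ → Ω → E) (B : Set E) (ω : Ω) : ℝ≥0∞ :=
  ∑' i, B.indicator 1 (X i ω)

omit [MeasurableSpace Ω] [MeasurableSpace E] in
lemma coe_count (X : ℕ → Ω → E) (B : Set E) (ω : Ω) : (count X B ω : ℝ≥0∞) = ecount X B ω := by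
  rw [count, ← ENNReal.tsum_set_one, tsum_subtype {i | X i ω ∈ B} (fun _ => (1 : ℝ≥0∞))]
  rfl

lemma IsPoissonProcess.measurable_ecount (hX : IsPoissonProcess X Λ μ) {B : Set E}
    (hB : MeasurableSet B) : Measurable (ecount X B) :=
  Measurable.tsum fun i => (measurable_one.indicator hB).comp (hX.measurable i)

/-- The count factors through the discrete space `ℕ∞`, so `u` may be arbitrary. -/
lemma IsPoissonProcess.lintegral_ecount_comp (hX : IsPoissonProcess X Λ μ) {B : Set E}
    (hB : MeasurableSet B) (hΛ : Λ B ≠ ∞) (u : ℝ≥0∞ → ℝ≥0∞) :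
    ∫⁻ ω, u (ecount X B ω) ∂μ = ∫⁻ n : ℕ, u n ∂(poissonMeasure (Λ B).toNNReal) := by
  have h := hX.count_law B hB hΛ
  calc ∫⁻ ω, u (ecount X B ω) ∂μ = ∫⁻ ω, (fun m : ℕ∞ => u m) (count X B ω) ∂μ := by
        simp_rw [coe_count]
    _ = ∫⁻ m : ℕ∞, u m ∂(μ.map (count X B)) :=
        (lintegral_map' (f := fun m : ℕ∞ => u m) Measurable.of_discrete.aemeasurable
          h.aemeasurable).symm
    _ = _ := by
        rw [h.map_eq, lintegral_map .of_discrete .of_discrete]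
        simp

lemma IsPoissonProcess.iIndepFun_ecount (hX : IsPoissonProcess X Λ μ) {ι : Type*} [Fintype ι]
    (B : ι → Set E) (hB : ∀ j, MeasurableSet (B j)) (hd : Pairwise fun j k => Disjoint (B j) (B k)) :
    iIndepFun (fun j => ecount X (B j)) μ := by
  have e := Fintype.equivFin ι
  have h := hX.count_indep (Fintype.card ι) (fun j => B (e.symm j)) (fun j => hB _)
    (fun j k hjk => hd (by simpa using hjk))
  have h2 := (h.precomp e.injective).comp (fun _ m => (m : ℝ≥0∞)) (fun _ => .of_discrete)
  convert h2 using 2 with j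
  ext ω
  simp [coe_count]

/-- The mean number of points is the intensity measure. -/
lemma IsPoissonProcess.lintegral_ecount_of_ne_top (hX : IsPoissonProcess X Λ μ) {B : Set E}
    (hB : MeasurableSet B) (hΛ : Λ B ≠ ∞) : ∫⁻ ω, ecount X B ω ∂μ = Λ B := by
  rw [hX.lintegral_ecount_comp hB hΛ (fun x => x), lintegral_poissonMeasure_natCast,
    ENNReal.coe_toNNReal hΛ]

lemma IsPoissonProcess.lintegral_ecount_eq_tsum (hX : IsPoissonProcess X Λ μ) {B : Set E}
    (hB : MeasurableSet B) : ∫⁻ ω, ecount X B ω ∂μ = ∑' i, μ.map (X i) B := by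
  have hm : ∀ i, Measurable fun ω => (B.indicator 1 (X i ω) : ℝ≥0∞) :=
    fun i => (measurable_one.indicator hB).comp (hX.measurable i)
  simp only [ecount]
  rw [lintegral_tsum fun i => (hm i).aemeasurable]
  congr with i
  rw [← lintegral_indicator_one hB, lintegral_map (measurable_one.indicator hB) (hX.measurable i)]

/-- The Poisson law is assumed only on sets of finite intensity. Both sides here are measures, so
exhausting by spanning sets extends the mean formula to sets of infinite intensity. -/
lemma IsPoissonProcess.sum_map_eq [SigmaFinite Λ] (hX : IsPoissonProcess X Λ μ) :
    Measure.sum (fun i => μ.map (X i)) = Λ := by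
  ext B hB
  have hm : ∀ ν : Measure E, ν B = ⨆ n, ν (B ∩ spanningSets Λ n) := fun ν => by
    rw [← Monotone.measure_iUnion (fun m n hmn => inter_subset_inter_right _ (monotone_spanningSets Λ hmn)),
      ← inter_iUnion, iUnion_spanningSets, inter_univ]
  rw [hm, hm Λ]
  congr with n
  have hBn := hB.inter (measurableSet_spanningSets Λ n)
  rw [Measure.sum_apply _ hBn, ← hX.lintegral_ecount_eq_tsum hBn, hX.lintegral_ecount_of_ne_top hBn
    ((measure_mono inter_subset_right).trans_lt (measure_spanningSets_lt_top Λ n)).ne]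

lemma IsPoissonProcess.lintegral_ecount [SigmaFinite Λ] (hX : IsPoissonProcess X Λ μ) {B : Set E}
    (hB : MeasurableSet B) : ∫⁻ ω, ecount X B ω ∂μ = Λ B := by
  rw [hX.lintegral_ecount_eq_tsum hB, ← Measure.sum_apply _ hB, hX.sum_map_eq]

lemma IsPoissonProcess.ae_forall_notMem [SigmaFinite Λ] (hX : IsPoissonProcess X Λ μ) {B : Set E}
    (hB : MeasurableSet B) (h0 : Λ B = 0) : ∀ᵐ ω ∂μ, ∀ i, X i ω ∉ B := by
  rw [← hX.lintegral_ecount hB, lintegral_eq_zero_iff (hX.measurable_ecount hB)] at h0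
  filter_upwards [h0] with ω hω i hi
  have := (ENNReal.tsum_eq_zero.1 hω) i
  simp [hi] at this

lemma IsPoissonProcess.ae_finite [SigmaFinite Λ] (hX : IsPoissonProcess X Λ μ) {B : Set E}
    (hB : MeasurableSet B) (hΛ : Λ B ≠ ∞) : ∀ᵐ ω ∂μ, {i | X i ω ∈ B}.Finite := by
  rw [← hX.lintegral_ecount hB] at hΛ
  filter_upwards [ae_lt_top (hX.measurable_ecount hB) hΛ] with ω hω
  rw [← coe_count, count] at hω
  by_contra hinf
  rw [Set.Infinite.encard_eq hinf] at hω
  simp at hω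

lemma IsPoissonProcess.measure_two_le_ecount (hX : IsPoissonProcess X Λ μ) {B : Set E}
    (hB : MeasurableSet B) (hΛ : Λ B ≠ ∞) : μ {ω | 2 ≤ ecount X B ω} ≤ Λ B ^ 2 := by
  have hm : MeasurableSet {ω | 2 ≤ ecount X B ω} :=
    measurableSet_le measurable_const (hX.measurable_ecount hB)
  calc μ {ω | 2 ≤ ecount X B ω}
      = ∫⁻ ω, (Ici (2 : ℝ≥0∞)).indicator 1 (ecount X B ω) ∂μ := by
        rw [← lintegral_indicator_one hm]; rfl
    _ = ∫⁻ n : ℕ, {n : ℕ | 2 ≤ n}.indicator 1 n ∂(poissonMeasure (Λ B).toNNReal) := by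
        rw [hX.lintegral_ecount_comp hB hΛ]
        congr with n
        simp only [indicator, mem_Ici, mem_ofPred_eq, Pi.one_apply]
        congr 1
        exact_mod_cast rfl
    _ ≤ _ := by
        rw [lintegral_indicator_one (by measurability)]
        simpa [ENNReal.coe_toNNReal hΛ] using poissonMeasure_two_le (Λ B).toNNReal

end Count

/-! ### The Laplace functional. -/

section Laplace

variable {Ω E : Type*} [MeasurableSpace Ω] [MeasurableSpace E] {X : ℕ → Ω → E} {Λ : Measure E}
  {μ : Measure Ω}

lemma lintegral_poissonMeasure_eexp (r : ℝ≥0) (c : ℝ≥0∞) :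
    ∫⁻ n : ℕ, eexp (n * c) ∂(poissonMeasure r) = eexp (r * (1 - eexp c)) := by
  have h1 := eexp_le_one c
  have ht : eexp c ≠ ∞ := (h1.trans_lt ENNReal.one_lt_top).ne
  have h2 : (eexp c).toReal ≤ 1 := by simpa using ENNReal.toReal_mono ENNReal.one_ne_top h1
  have := lintegral_poissonMeasure_pow r ENNReal.toReal_nonneg h2
  rw [ENNReal.ofReal_sub _ ENNReal.toReal_nonneg, ENNReal.ofReal_toReal ht, ENNReal.ofReal_one] at this
  simpa only [eexp_nsmul] using this

-- The condition `F 0 = 0` lets the fibre over `0` be left out; that fibre may have infinite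
-- intensity.
omit [MeasurableSpace Ω] in
lemma simpleFunc_comp_eq_sum (g : SimpleFunc E ℝ≥0∞) {F : ℝ≥0∞ → ℝ≥0∞} (hF : F 0 = 0) (x : E) :
    F (g x) = ∑ c : {c // c ∈ g.range.erase 0}, F c * (g ⁻¹' {c.1}).indicator 1 x := by
  rw [Finset.sum_coe_sort (g.range.erase 0) (fun c => F c * (g ⁻¹' {c}).indicator 1 x)]
  by_cases h : g x = 0
  · rw [h, hF, Finset.sum_eq_zero]
    intro c hc
    have : g x ≠ c := by rw [h]; exact (Finset.ne_of_mem_erase hc).symm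
    simp [this]
  · rw [Finset.sum_eq_single (g x)]
    · simp
    · intro c _ hc
      simp [hc.symm]
    · intro hx
      exact absurd (Finset.mem_erase.2 ⟨h, g.mem_range_self x⟩) hx

/-- Laplace functional of a simple function, jointly with the numbers of points in two sets off
its support. -/
lemma IsPoissonProcess.laplace_simpleFunc (hX : IsPoissonProcess X Λ μ) {B₁ B₂ C : Set E}
    (hB₁ : MeasurableSet B₁) (hB₂ : MeasurableSet B₂) (hC : Λ C ≠ ∞) (h12 : Disjoint B₁ B₂)
    (h1C : Disjoint B₁ C) (h2C : Disjoint B₂ C) {u₁ u₂ : ℝ≥0∞ → ℝ≥0∞} (hu₁ : Measurable u₁)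
    (hu₂ : Measurable u₂) (g : SimpleFunc E ℝ≥0∞) (hg : ∀ x, g x ≠ 0 → x ∈ C) :
    ∫⁻ ω, u₁ (ecount X B₁ ω) * u₂ (ecount X B₂ ω) * eexp (∑' i, g (X i ω)) ∂μ =
      (∫⁻ ω, u₁ (ecount X B₁ ω) * u₂ (ecount X B₂ ω) ∂μ) * eexp (∫⁻ x, (1 - eexp (g x)) ∂Λ) := by
  let S := {c // c ∈ g.range.erase 0}
  -- The two sets and the fibres over nonzero values form one disjoint family, so a single
  -- independence statement covers all the counts.
  let B : Bool ⊕ S → Set E := Sum.elim (fun b => cond b B₁ B₂) (fun c => g ⁻¹' {c.1})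
  let u : Bool ⊕ S → ℝ≥0∞ → ℝ≥0∞ := Sum.elim (fun b => cond b u₁ u₂) (fun c x => eexp (x * c.1))
  have hS : ∀ c : S, g ⁻¹' {c.1} ⊆ C := fun c x hx => hg x (by
    rw [mem_preimage, mem_singleton_iff] at hx
    rw [hx]; exact Finset.ne_of_mem_erase c.2)
  have hB : ∀ j, MeasurableSet (B j) := by
    rintro ((_ | _) | c)
    · exact hB₂
    · exact hB₁
    · exact g.measurableSet_fiber _
  have hd : Pairwise fun j k => Disjoint (B j) (B k) := by
    rintro ((_ | _) | c) ((_ | _) | c') h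
    · exact absurd rfl h
    · exact h12.symm
    · exact h2C.mono_right (hS _)
    · exact h12
    · exact absurd rfl h
    · exact h1C.mono_right (hS _)
    · exact (h2C.mono_right (hS _)).symm
    · exact (h1C.mono_right (hS _)).symm
    · refine Disjoint.preimage g (disjoint_singleton.2 fun hc => h ?_)
      rw [Subtype.ext hc]
  have hu : ∀ j, Measurable (u j) := by
    rintro ((_ | _) | c)
    · exact hu₂
    · exact hu₁
    · exact measurable_eexp.comp (measurable_id.mul_const _)
  have hind := (hX.iIndepFun_ecount B hB hd).comp u hu
  have hm : ∀ j, Measurable (u j ∘ ecount X (B j)) := fun j => (hu j).comp (hX.measurable_ecount (hB j))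
  have hsum : ∀ ω, ∑' i, g (X i ω) = ∑ c : S, ecount X (g ⁻¹' {c.1}) ω * c.1 := fun ω => by
    simp_rw [fun i => simpleFunc_comp_eq_sum g (F := fun y => y) rfl (X i ω), ecount,
      ← ENNReal.tsum_mul_right]
    rw [Summable.tsum_finsetSum fun _ _ => ENNReal.summable]
    simp_rw [mul_comm]
    rfl
  have hint : ∫⁻ x, (1 - eexp (g x)) ∂Λ = ∑ c : S, Λ (g ⁻¹' {c.1}) * (1 - eexp c) := by
    simp_rw [fun x => simpleFunc_comp_eq_sum g (F := fun y => 1 - eexp y) (by simp) x]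
    rw [lintegral_finsetSum _ fun c _ => by
      exact (measurable_one.indicator (g.measurableSet_fiber _)).const_mul _]
    congr with c
    rw [lintegral_const_mul _ (measurable_one.indicator (g.measurableSet_fiber _)),
      lintegral_indicator_one (g.measurableSet_fiber _), mul_comm]
  have hL := lintegral_prod_eq_prod_lintegral_of_indepFun Finset.univ _ hind hm
  -- Factorization over the two sets alone, used backwards to reassemble the joint integral of `u₁`
  -- and `u₂`.
  have h2 := lintegral_prod_eq_prod_lintegral_of_indepFun (Finset.univ.map Function.Embedding.inl)
    _ hind hm
  simp only [Finset.prod_map, Fintype.prod_sum_type, Fintype.prod_bool] at hL h2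
  simp only [Function.comp_apply, Function.Embedding.inl_apply, u, B, Sum.elim_inl, Sum.elim_inr,
    cond_true, cond_false] at hL h2
  simp_rw [hsum, eexp_sum]
  rw [hL, ← h2, hint, eexp_sum]
  congr 1
  refine Finset.prod_congr rfl fun c _ => ?_
  have hfin : Λ (g ⁻¹' {c.1}) ≠ ∞ := ((measure_mono (hS c)).trans_lt hC.lt_top).ne
  rw [hX.lintegral_ecount_comp (g.measurableSet_fiber _) hfin (fun x => eexp (x * c.1)),
    lintegral_poissonMeasure_eexp, ENNReal.coe_toNNReal hfin]

lemma tendsto_tsum_of_monotone {ι : Type*} {f : ℕ → ι → ℝ≥0∞} {F : ι → ℝ≥0∞}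
    (hf : ∀ i, Monotone fun n => f n i) (hF : ∀ i, Tendsto (fun n => f n i) atTop (𝓝 (F i))) :
    Tendsto (fun n => ∑' i, f n i) atTop (𝓝 (∑' i, F i)) := by
  let _ : MeasurableSpace ι := ⊤
  simp_rw [← lintegral_count]
  exact lintegral_tendsto_of_tendsto_of_monotone (fun n => measurable_from_top.aemeasurable)
    (ae_of_all _ hf) (ae_of_all _ hF)

/-- Laplace functional of a Poisson process, jointly with the numbers of points in two sets off
the support of the test function. -/
lemma IsPoissonProcess.laplace (hX : IsPoissonProcess X Λ μ) {B₁ B₂ C : Set E}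
    (hB₁ : MeasurableSet B₁) (hB₂ : MeasurableSet B₂) (hC : Λ C ≠ ∞) (h12 : Disjoint B₁ B₂)
    (h1C : Disjoint B₁ C) (h2C : Disjoint B₂ C) {u₁ u₂ : ℝ≥0∞ → ℝ≥0∞} (hu₁ : Measurable u₁)
    (hu₂ : Measurable u₂) (hu : ∫⁻ ω, u₁ (ecount X B₁ ω) * u₂ (ecount X B₂ ω) ∂μ ≠ ∞)
    {g : E → ℝ≥0∞} (hgm : Measurable g) (hg : ∀ x, g x ≠ 0 → x ∈ C) :
    ∫⁻ ω, u₁ (ecount X B₁ ω) * u₂ (ecount X B₂ ω) * eexp (∑' i, g (X i ω)) ∂μ =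
      (∫⁻ ω, u₁ (ecount X B₁ ω) * u₂ (ecount X B₂ ω) ∂μ) * eexp (∫⁻ x, (1 - eexp (g x)) ∂Λ) := by
  -- Approximate `g` from below by simple functions: dominated convergence on the left, where `hu`
  -- supplies the bound, and monotone convergence inside the exponential on the right.
  have hlim : ∀ x, Tendsto (fun n => SimpleFunc.eapprox g n x) atTop (𝓝 (g x)) := fun x => by
    rw [← SimpleFunc.iSup_eapprox_apply hgm x]
    exact tendsto_atTop_iSup fun m n hmn => SimpleFunc.monotone_eapprox g hmn x
  have hle : ∀ n x, SimpleFunc.eapprox g n x ≤ g x := fun n x => by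
    rw [← SimpleFunc.iSup_eapprox_apply hgm x]
    exact le_iSup (fun n => SimpleFunc.eapprox g n x) n
  have hW : Measurable fun ω => u₁ (ecount X B₁ ω) * u₂ (ecount X B₂ ω) :=
    (hu₁.comp (hX.measurable_ecount hB₁)).mul (hu₂.comp (hX.measurable_ecount hB₂))
  have hs : ∀ n, Measurable fun ω => ∑' i, SimpleFunc.eapprox g n (X i ω) := fun n =>
    Measurable.tsum fun i => (SimpleFunc.eapprox g n).measurable.comp (hX.measurable i)
  have hL : Tendsto (fun n => ∫⁻ ω, u₁ (ecount X B₁ ω) * u₂ (ecount X B₂ ω) *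
      eexp (∑' i, SimpleFunc.eapprox g n (X i ω)) ∂μ) atTop
      (𝓝 (∫⁻ ω, u₁ (ecount X B₁ ω) * u₂ (ecount X B₂ ω) * eexp (∑' i, g (X i ω)) ∂μ)) := by
    refine tendsto_lintegral_of_dominated_convergence _
      (fun n => hW.mul (measurable_eexp.comp (hs n)))
      (fun n => ae_of_all _ fun ω => mul_le_of_le_one_right' (eexp_le_one _)) hu ?_
    filter_upwards [ae_lt_top hW hu] with ω hω
    refine ENNReal.Tendsto.const_mul ((continuous_eexp.tendsto _).comp ?_) (Or.inr hω.ne)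
    exact tendsto_tsum_of_monotone (fun i m n hmn => SimpleFunc.monotone_eapprox g hmn _)
      fun i => hlim _
  have hR : Tendsto (fun n => ∫⁻ x, (1 - eexp (SimpleFunc.eapprox g n x)) ∂Λ) atTop
      (𝓝 (∫⁻ x, (1 - eexp (g x)) ∂Λ)) := by
    refine lintegral_tendsto_of_tendsto_of_monotone
      (fun n => (measurable_const.sub (measurable_eexp.comp
        (SimpleFunc.eapprox g n).measurable)).aemeasurable)
      (ae_of_all _ fun x m n hmn => tsub_le_tsub_left
        (eexp_antitone (SimpleFunc.monotone_eapprox g hmn x)) _) (ae_of_all _ fun x => ?_)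
    exact ENNReal.Tendsto.sub tendsto_const_nhds ((continuous_eexp.tendsto _).comp (hlim x))
      (Or.inl ENNReal.one_ne_top)
  refine tendsto_nhds_unique hL ?_
  simp_rw [fun n => hX.laplace_simpleFunc hB₁ hB₂ hC h12 h1C h2C hu₁ hu₂ (SimpleFunc.eapprox g n)
    fun x hx => hg x fun h0 => hx (le_antisymm ((hle n x).trans_eq h0) zero_le)]
  exact ENNReal.Tendsto.const_mul ((continuous_eexp.tendsto _).comp hR) (Or.inr hu)

end Laplace

/-! ### Grids on the level axis and almost sure distinctness of levels. -/

section Simple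

variable {Ω E : Type*} [MeasurableSpace Ω] [MeasurableSpace E] {X : ℕ → Ω → E} {Λ : Measure E}
  {μ : Measure Ω} {ξ : E → ℝ}

/-- Index of the cell `((k - 1) / (n + 1), k / (n + 1)]` of the `n`-th grid that contains `x`. -/
noncomputable def cell (n : ℕ) (x : ℝ) : ℤ := ⌈x * (n + 1)⌉

/-- Right end point of the `k`-th cell of the `n`-th grid. -/
noncomputable def gridPoint (n : ℕ) (k : ℤ) : ℝ := k / (n + 1)

lemma measurable_cell (n : ℕ) : Measurable (cell n) :=
  Int.measurable_ceil.comp (measurable_id.mul_const _)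

lemma cell_le_iff {n : ℕ} {x : ℝ} {k : ℤ} : cell n x ≤ k ↔ x ≤ gridPoint n k := by
  rw [cell, gridPoint, Int.ceil_le, le_div_iff₀ (by positivity)]

lemma le_gridPoint_cell (n : ℕ) (x : ℝ) : x ≤ gridPoint n (cell n x) := cell_le_iff.1 le_rfl

lemma gridPoint_cell_lt (n : ℕ) (x : ℝ) : gridPoint n (cell n x) < x + 1 / (n + 1) := by
  have h := Int.ceil_lt_add_one (x * ((n : ℝ) + 1))
  rw [gridPoint, cell, div_lt_iff₀ (by positivity), add_mul, one_div_mul_cancel (by positivity)]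
  exact h

lemma tendsto_gridPoint_cell (x : ℝ) : Tendsto (fun n => gridPoint n (cell n x)) atTop (𝓝 x) := by
  refine tendsto_of_tendsto_of_tendsto_of_le_of_le tendsto_const_nhds ?_
    (fun n => le_gridPoint_cell n x) (fun n => (gridPoint_cell_lt n x).le)
  simpa using tendsto_const_nhds.add (tendsto_one_div_add_atTop_nhds_zero_nat (𝕜 := ℝ))

lemma abs_sub_le_of_cell_eq {n : ℕ} {x y : ℝ} (h : cell n x = cell n y) :
    |x - y| ≤ 1 / (n + 1) := by
  have h1 := le_gridPoint_cell n x
  have h2 := gridPoint_cell_lt n x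
  have h3 := le_gridPoint_cell n y
  have h4 := gridPoint_cell_lt n y
  rw [h] at h1 h2
  rw [abs_le]
  constructor <;> linarith

/-- As `n` grows the strips around `ξ z` shrink to a level set, which is null; the constant `Λ A`
dominates. -/
lemma tendsto_lintegral_measure_near [SigmaFinite Λ] (hξ : Measurable ξ)
    (hnull : ∀ c, Λ {z | ξ z = c} = 0) {A : Set E} (hA : MeasurableSet A) (hΛ : Λ A ≠ ∞) :
    Tendsto (fun n : ℕ => ∫⁻ z in A, Λ (A ∩ {w | |ξ w - ξ z| ≤ 1 / (n + 1)}) ∂Λ) atTop (𝓝 0) := by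
  have hm : ∀ n : ℕ, MeasurableSet {p : E × E | p.2 ∈ A ∧ |ξ p.2 - ξ p.1| ≤ 1 / ((n : ℝ) + 1)} :=
    fun n => (measurable_snd hA).inter (measurableSet_le
      (((hξ.comp measurable_snd).sub (hξ.comp measurable_fst)).abs) measurable_const)
  rw [← lintegral_zero (μ := Λ.restrict A)]
  refine tendsto_lintegral_of_dominated_convergence (fun _ => Λ A)
    (fun n => measurable_measure_prodMk_left (hm n))
    (fun n => ae_of_all _ fun z => measure_mono inter_subset_left)
    (by simpa using ENNReal.mul_ne_top hΛ hΛ) (ae_of_all _ fun z => ?_)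
  have h0 : Λ (⋂ n : ℕ, A ∩ {w | |ξ w - ξ z| ≤ 1 / ((n : ℝ) + 1)}) = 0 := by
    refine measure_mono_null (fun w hw => ?_) (hnull (ξ z))
    have h1 : |ξ w - ξ z| ≤ 0 := ge_of_tendsto' (tendsto_one_div_add_atTop_nhds_zero_nat (𝕜 := ℝ))
      fun n => ((mem_iInter.1 hw) n).2
    exact sub_eq_zero.1 (abs_nonpos_iff.1 h1)
  rw [← h0]
  refine tendsto_measure_iInter_atTop (fun n => ?_) (fun m n hmn => ?_)
    ⟨0, ((measure_mono inter_subset_left).trans_lt hΛ.lt_top).ne⟩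
  · exact (hA.inter (measurableSet_le ((hξ.sub_const _).abs) measurable_const)).nullMeasurableSet
  · refine inter_subset_inter_right _ fun w hw => ?_
    have hmn' : (m : ℝ) + 1 ≤ n + 1 := by exact_mod_cast Nat.succ_le_succ hmn
    have hw' : |ξ w - ξ z| ≤ 1 / ((n : ℝ) + 1) := hw
    exact hw'.trans (one_div_le_one_div_of_le (by positivity) hmn')

omit [MeasurableSpace Ω] [MeasurableSpace E] in
lemma two_le_ecount {B : Set E} {ω : Ω} {i j : ℕ} (hij : i ≠ j) (hi : X i ω ∈ B) (hj : X j ω ∈ B) :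
    2 ≤ ecount X B ω := by
  have := ENNReal.sum_le_tsum (f := fun i => B.indicator (1 : E → ℝ≥0∞) (X i ω)) {i, j}
  rw [Finset.sum_pair hij] at this
  simpa [ecount, hi, hj, one_add_one_eq_two] using this

/-- If the level sets of `ξ` are null for the intensity measure, then almost surely no two points
lie on the same level set. -/
lemma IsPoissonProcess.ae_injective [SigmaFinite Λ] (hX : IsPoissonProcess X Λ μ)
    (hξ : Measurable ξ) (hfin : ∀ R, Λ {z | ξ z ≤ R} ≠ ∞) (hnull : ∀ c, Λ {z | ξ z = c} = 0) :
    ∀ᵐ ω ∂μ, Function.Injective fun i => ξ (X i ω) := by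
  have key : ∀ R : ℕ, ∀ᵐ ω ∂μ, ∀ i j, i ≠ j → ξ (X i ω) ≤ R → ξ (X i ω) ≠ ξ (X j ω) := by
    intro R
    set A : Set E := {z | ξ z ≤ R} with hA_def
    have hA : MeasurableSet A := measurableSet_le hξ measurable_const
    have hΛ : Λ A ≠ ∞ := hfin R
    rw [ae_iff]
    refine le_antisymm ?_ zero_le
    -- Two points on one level share a grid cell, which has probability at most `∑ Λ(S k)²`. Since
    -- `Λ(S k)²` is the integral of `Λ(S k)` over `S k`, and a cell lies within `1 / (n + 1)` of
    -- each of its points in level, the integral that tends to zero dominates.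
    refine ge_of_tendsto' (tendsto_lintegral_measure_near hξ hnull hA hΛ) fun n => ?_
    let S : ℤ → Set E := fun k => A ∩ {z | cell n (ξ z) = k}
    have hS : ∀ k, MeasurableSet (S k) := fun k =>
      hA.inter (((measurable_cell n).comp hξ) (measurableSet_singleton k))
    have hSd : Pairwise (Function.onFun Disjoint S) := fun k l hkl =>
      Set.disjoint_left.2 fun z hz hz' => hkl (hz.2.symm.trans hz'.2)
    have hSA : ∀ k, S k ⊆ A := fun k => inter_subset_left
    have hSf : ∀ k, Λ (S k) ≠ ∞ := fun k => ((measure_mono (hSA k)).trans_lt hΛ.lt_top).ne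
    calc μ {ω | ¬∀ i j, i ≠ j → ξ (X i ω) ≤ R → ξ (X i ω) ≠ ξ (X j ω)}
        ≤ μ (⋃ k, {ω | 2 ≤ ecount X (S k) ω}) := by
          refine measure_mono fun ω hω => ?_
          simp only [mem_ofPred_eq] at hω
          push Not at hω
          obtain ⟨i, j, hij, hi, he⟩ := hω
          refine mem_iUnion.2 ⟨cell n (ξ (X i ω)), two_le_ecount hij ⟨hi, rfl⟩ ⟨?_, ?_⟩⟩
          · rw [hA_def, mem_ofPred_eq, ← he]; exact hi
          · rw [mem_ofPred_eq, he]
      _ ≤ ∑' k, μ {ω | 2 ≤ ecount X (S k) ω} := measure_iUnion_le _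
      _ ≤ ∑' k, Λ (S k) ^ 2 := ENNReal.tsum_le_tsum fun k => hX.measure_two_le_ecount (hS k) (hSf k)
      _ ≤ ∑' k, ∫⁻ z in S k, Λ (A ∩ {w | |ξ w - ξ z| ≤ 1 / (n + 1)}) ∂Λ := by
          refine ENNReal.tsum_le_tsum fun k => ?_
          rw [sq, ← setLIntegral_const]
          refine setLIntegral_mono' (hS k) fun z hz => measure_mono fun w hw => ⟨hw.1, ?_⟩
          exact abs_sub_le_of_cell_eq (hw.2.trans hz.2.symm)
      _ = ∫⁻ z in ⋃ k, S k, Λ (A ∩ {w | |ξ w - ξ z| ≤ 1 / (n + 1)}) ∂Λ :=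
          (lintegral_iUnion hS hSd _).symm
      _ ≤ _ := lintegral_mono_set (iUnion_subset hSA)
  filter_upwards [ae_all_iff.2 key] with ω hω i j hij
  by_contra h
  obtain ⟨R, hR⟩ := exists_nat_ge (ξ (X i ω))
  exact hω R i j h hR hij

end Simple

/-! ### Discretizing the point of least level. -/

section Nearest

variable {Ω E : Type*} [MeasurableSpace Ω] [MeasurableSpace E] {X : ℕ → Ω → E} {Λ : Measure E}
  {μ : Measure Ω} {ξ : E → ℝ} {g : ℝ → ℝ → ℝ≥0∞}

/-- `g t (ξ z)` for points with `t < ξ z ≤ R`, and `0` for the others. -/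
noncomputable def shellFun (ξ : E → ℝ) (g : ℝ → ℝ → ℝ≥0∞) (t R : ℝ) (z : E) : ℝ≥0∞ :=
  open Classical in if t < ξ z ∧ ξ z ≤ R then g t (ξ z) else 0

/-- `g t (ξ z)` for points with `t < ξ z`, and `0` for the others. -/
noncomputable def tailFun (ξ : E → ℝ) (g : ℝ → ℝ → ℝ≥0∞) (t : ℝ) (z : E) : ℝ≥0∞ :=
  open Classical in if t < ξ z then g t (ξ z) else 0

lemma measurable_shellFun (hξ : Measurable ξ) (hg : Measurable (Function.uncurry g)) (R : ℝ) :
    Measurable fun p : ℝ × E => shellFun ξ g p.1 R p.2 :=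
  Measurable.ite ((measurableSet_lt measurable_fst (hξ.comp measurable_snd)).inter
    (measurableSet_le (hξ.comp measurable_snd) measurable_const))
    (hg.comp (measurable_fst.prodMk (hξ.comp measurable_snd))) measurable_const

lemma measurable_tailFun (hξ : Measurable ξ) (hg : Measurable (Function.uncurry g)) :
    Measurable fun p : ℝ × E => tailFun ξ g p.1 p.2 :=
  Measurable.ite (measurableSet_lt measurable_fst (hξ.comp measurable_snd))
    (hg.comp (measurable_fst.prodMk (hξ.comp measurable_snd))) measurable_const

-- Only right-continuity in the threshold holds, hence `x ≤ τ n`: a point with `ξ z = x` is excluded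
-- at `x` but would be included at smaller thresholds. Right end points of cells approach from the
-- correct side.
omit [MeasurableSpace E] in
lemma tendsto_shellFun (hc : ∀ x y, 0 < x → 0 < y → ContinuousAt (fun t => g t y) x) (R : ℝ) {x : ℝ}
    (hx : 0 < x) {τ : ℕ → ℝ} (hτ : Tendsto τ atTop (𝓝 x)) (hle : ∀ n, x ≤ τ n) (z : E) :
    Tendsto (fun n => shellFun ξ g (τ n) R z) atTop (𝓝 (shellFun ξ g x R z)) := by
  by_cases hz : x < ξ z
  · have h1 : ∀ᶠ n in atTop, τ n < ξ z := hτ.eventually_lt_const hz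
    by_cases hR : ξ z ≤ R
    · have h2 : shellFun ξ g x R z = g x (ξ z) := by simp [shellFun, hz, hR]
      rw [h2]
      refine ((hc x (ξ z) hx (hx.trans hz)).tendsto.comp hτ).congr' ?_
      filter_upwards [h1] with n hn
      simp [shellFun, hn, hR]
    · simp [shellFun, hR]
  · have h1 : ∀ n, ¬ τ n < ξ z := fun n => not_lt.2 ((not_lt.1 hz).trans (hle n))
    simp [shellFun, hz, h1]

omit [MeasurableSpace E] in
lemma monotone_shellFun (ξ : E → ℝ) (g : ℝ → ℝ → ℝ≥0∞) (t : ℝ) (z : E) :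
    Monotone fun m : ℕ => shellFun ξ g t m z := by
  intro m n hmn
  simp only [shellFun]
  split_ifs with h1 h2
  · exact le_rfl
  · exact absurd ⟨h1.1, h1.2.trans (by exact_mod_cast hmn)⟩ h2
  · exact zero_le
  · exact le_rfl

omit [MeasurableSpace E] in
lemma tendsto_shellFun_atTop (ξ : E → ℝ) (g : ℝ → ℝ → ℝ≥0∞) (t : ℝ) (z : E) :
    Tendsto (fun m : ℕ => shellFun ξ g t m z) atTop (𝓝 (tailFun ξ g t z)) := by
  refine tendsto_const_nhds.congr' ?_
  filter_upwards [(tendsto_natCast_atTop_atTop (R := ℝ)).eventually_ge_atTop (ξ z)] with m hm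
  simp [shellFun, tailFun, hm]

lemma measurable_eval_index {ι : Ω → ℕ} (hX : ∀ i, Measurable (X i)) (hι : Measurable ι) :
    Measurable fun ω => X (ι ω) ω :=
  (measurable_from_prod_countable_right (f := fun p : ℕ × Ω => X p.1 p.2) hX).comp
    (hι.prodMk measurable_id)

/-- Almost sure regularity of the configuration: positive, distinct and locally finite levels. -/
structure IsRegularAt (ξ : E → ℝ) (X : ℕ → Ω → E) (ω : Ω) : Prop where
  pos : ∀ i, 0 < ξ (X i ω)
  injective : Function.Injective fun i => ξ (X i ω)
  finite : ∀ R : ℝ, {i | ξ (X i ω) ≤ R}.Finite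

lemma IsPoissonProcess.ae_isRegularAt [SigmaFinite Λ] (hX : IsPoissonProcess X Λ μ)
    (hξ : Measurable ξ) (hξ0 : ∀ z, 0 ≤ ξ z) (hfin : ∀ R, Λ {z | ξ z ≤ R} ≠ ∞)
    (hnull : ∀ c, Λ {z | ξ z = c} = 0) : ∀ᵐ ω ∂μ, IsRegularAt ξ X ω := by
  filter_upwards [hX.ae_injective hξ hfin hnull,
    hX.ae_forall_notMem (hξ (measurableSet_singleton 0)) (hnull 0),
    ae_all_iff.2 fun R : ℕ => hX.ae_finite (B := {z | ξ z ≤ (R : ℝ)})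
      (measurableSet_le hξ measurable_const) (hfin R)] with ω h1 h2 h3
  refine ⟨fun i => lt_of_le_of_ne (hξ0 _) fun h => h2 i h.symm, h1, fun R => ?_⟩
  obtain ⟨n, hn⟩ := exists_nat_ge R
  exact (h3 n).subset fun i hi => le_trans (show ξ (X i ω) ≤ R from hi) hn

omit [MeasurableSpace Ω] [MeasurableSpace E] in
lemma IsRegularAt.exists_forall_le {ω : Ω} (h : IsRegularAt ξ X ω) :
    ∃ i, ∀ j, ξ (X i ω) ≤ ξ (X j ω) := by
  obtain ⟨i, hi, hmin⟩ := exists_min_image _ (fun i => ξ (X i ω)) (h.finite (ξ (X 0 ω)))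
    ⟨0, le_refl (ξ (X 0 ω))⟩
  refine ⟨i, fun j => ?_⟩
  by_cases hj : ξ (X j ω) ≤ ξ (X 0 ω)
  · exact hmin j hj
  · exact le_trans (show ξ (X i ω) ≤ ξ (X 0 ω) from hi) (not_le.1 hj).le

/-- Indicator that exactly one point has its level in a cell or below, and that this point lies
in the cell and in `D`. -/
noncomputable def uniqueIn (ξ : E → ℝ) (X : ℕ → Ω → E) (D : Set E) (n : ℕ) (k : ℤ) (ω : Ω) :
    ℝ≥0∞ :=
  ({1} : Set ℝ≥0∞).indicator 1 (ecount X (D ∩ {z | cell n (ξ z) = k}) ω) *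
    ({0} : Set ℝ≥0∞).indicator 1 (ecount X ({z | cell n (ξ z) ≤ k} \ (D ∩ {z | cell n (ξ z) = k})) ω)

omit [MeasurableSpace Ω] [MeasurableSpace E] in
lemma uniqueIn_le_one (D : Set E) (n : ℕ) (k : ℤ) (ω : Ω) : uniqueIn ξ X D n k ω ≤ 1 :=
  mul_le_one' (indicator_le_self' (fun _ _ => zero_le) _) (indicator_le_self' (fun _ _ => zero_le) _)

-- If the indicator is nonzero, some point lies in cell `k`, so the minimizer is in that cell or
-- below; everything below being empty, it is in cell `k` itself. Hence at most one `k` contributes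
-- for each grid.
omit [MeasurableSpace Ω] [MeasurableSpace E] in
lemma uniqueIn_eq_zero {D : Set E} {n : ℕ} {k : ℤ} {ω : Ω} {i₀ : ℕ}
    (hi₀ : ∀ j, ξ (X i₀ ω) ≤ ξ (X j ω)) (hk : k ≠ cell n (ξ (X i₀ ω))) :
    uniqueIn ξ X D n k ω = 0 := by
  by_contra h
  obtain ⟨h1, h2⟩ := mul_ne_zero_iff.1 h
  have h1 := mem_of_indicator_ne_zero h1
  have h2 := mem_of_indicator_ne_zero h2
  rw [mem_singleton_iff] at h1 h2
  have h3 : ∀ j, X j ω ∉ {z | cell n (ξ z) ≤ k} \ (D ∩ {z | cell n (ξ z) = k}) := fun j hj => by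
    have := ENNReal.tsum_eq_zero.1 h2 j
    simp [hj] at this
  have h4 : ∃ j, X j ω ∈ D ∩ {z | cell n (ξ z) = k} := by
    by_contra! hno
    have : ecount X (D ∩ {z | cell n (ξ z) = k}) ω = 0 :=
      ENNReal.tsum_eq_zero.2 fun j => indicator_of_notMem (hno j) _
    rw [this] at h1
    exact zero_ne_one h1
  obtain ⟨j, hj⟩ := h4
  have hle : cell n (ξ (X i₀ ω)) ≤ k := by
    rw [cell_le_iff]
    exact (hi₀ j).trans (cell_le_iff.1 (le_of_eq hj.2))
  refine h3 i₀ ⟨hle, fun h5 => hk h5.2.symm⟩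

-- Distinctness and local finiteness leave a gap above the least level, and a fine enough grid has a
-- cell boundary inside it.
omit [MeasurableSpace Ω] [MeasurableSpace E] in
lemma IsRegularAt.eventually_uniqueIn {ω : Ω} (h : IsRegularAt ξ X ω) (D : Set E) {i₀ : ℕ}
    (hi₀ : ∀ j, ξ (X i₀ ω) ≤ ξ (X j ω)) :
    ∀ᶠ n in atTop, uniqueIn ξ X D n (cell n (ξ (X i₀ ω))) ω = D.indicator 1 (X i₀ ω) := by
  set x := ξ (X i₀ ω) with hx
  have hτ := tendsto_gridPoint_cell x
  have hlt : ∀ j, j ≠ i₀ → x < ξ (X j ω) := fun j hj =>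
    lt_of_le_of_ne (hi₀ j) fun he => hj (h.injective he.symm)
  -- Only the finitely many points of level at most `x + 1` can compete; this makes the choice of
  -- `n` uniform in `j`.
  have hall : ∀ᶠ n in atTop, ∀ j ∈ {i | ξ (X i ω) ≤ x + 1}, j ≠ i₀ →
      gridPoint n (cell n x) < ξ (X j ω) := by
    rw [(h.finite (x + 1)).eventually_all]
    intro j _
    by_cases hj : j = i₀
    · simp [hj]
    · filter_upwards [hτ.eventually_lt_const (hlt j hj)] with n hn _ using hn
  filter_upwards [hall, hτ.eventually_lt_const (lt_add_one x)] with n h1 h2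
  have h3 : ∀ j, j ≠ i₀ → ¬ cell n (ξ (X j ω)) ≤ cell n x := fun j hj => by
    rw [cell_le_iff, not_le]
    by_cases hj1 : ξ (X j ω) ≤ x + 1
    · exact h1 j hj1 hj
    · exact h2.trans (not_le.1 hj1)
  have e1 : ecount X (D ∩ {z | cell n (ξ z) = cell n x}) ω = D.indicator 1 (X i₀ ω) := by
    rw [ecount, tsum_eq_single i₀ fun j hj => indicator_of_notMem
      (fun hm => h3 j hj (le_of_eq hm.2)) _]
    by_cases hD : X i₀ ω ∈ D <;> simp [indicator, hD, ← hx]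
  have e2 : ecount X ({z | cell n (ξ z) ≤ cell n x} \ (D ∩ {z | cell n (ξ z) = cell n x})) ω
      = Dᶜ.indicator 1 (X i₀ ω) := by
    rw [ecount, tsum_eq_single i₀ fun j hj => indicator_of_notMem
      (fun hm => h3 j hj hm.1) _]
    by_cases hD : X i₀ ω ∈ D <;> simp [indicator, hD, ← hx]
  rw [uniqueIn, e1, e2]
  by_cases hD : X i₀ ω ∈ D <;> simp [hD]

lemma IsPoissonProcess.measurable_uniqueIn (hX : IsPoissonProcess X Λ μ) (hξ : Measurable ξ)
    {D : Set E} (hD : MeasurableSet D) (n : ℕ) (k : ℤ) : Measurable (uniqueIn ξ X D n k) := by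
  have hc := (measurable_cell n).comp hξ
  have hB : MeasurableSet (D ∩ {z | cell n (ξ z) = k}) := hD.inter (hc (measurableSet_singleton k))
  refine Measurable.mul ?_ ?_
  · exact (measurable_one.indicator (measurableSet_singleton _)).comp (hX.measurable_ecount hB)
  · exact (measurable_one.indicator (measurableSet_singleton _)).comp
      (hX.measurable_ecount ((hc measurableSet_Iic).diff hB))

/-- The indicator depends on points of level at most `gridPoint n k`, the sum on points strictly
beyond it. The threshold is deterministic, so the Laplace functional applies. -/
lemma IsPoissonProcess.lintegral_uniqueIn_mul [IsProbabilityMeasure μ]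
    (hX : IsPoissonProcess X Λ μ) (hξ : Measurable ξ)
    (hfin : ∀ R, Λ {z | ξ z ≤ R} ≠ ∞) (hg : Measurable (Function.uncurry g))
    {D : Set E} (hD : MeasurableSet D) (n : ℕ) (k : ℤ) (R : ℝ) :
    ∫⁻ ω, uniqueIn ξ X D n k ω * eexp (∑' i, shellFun ξ g (gridPoint n k) R (X i ω)) ∂μ =
      ∫⁻ ω, uniqueIn ξ X D n k ω *
        eexp (∫⁻ z, (1 - eexp (shellFun ξ g (gridPoint n k) R z)) ∂Λ) ∂μ := by
  have hc := (measurable_cell n).comp hξ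
  have hB : MeasurableSet (D ∩ {z | cell n (ξ z) = k}) := hD.inter (hc (measurableSet_singleton k))
  have hCd : Disjoint {z | cell n (ξ z) ≤ k} {z | gridPoint n k < ξ z ∧ ξ z ≤ R} :=
    Set.disjoint_left.2 fun z hz hz' => not_lt.2 (cell_le_iff.1 hz) hz'.1
  rw [lintegral_mul_const _ (hX.measurable_uniqueIn hξ hD n k)]
  refine hX.laplace (C := {z | gridPoint n k < ξ z ∧ ξ z ≤ R}) hB ((hc measurableSet_Iic).diff hB)
    ?_ disjoint_sdiff_right (hCd.mono_left fun z hz => le_of_eq hz.2)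
    (hCd.mono_left sdiff_subset) (measurable_one.indicator (measurableSet_singleton _))
    (measurable_one.indicator (measurableSet_singleton _)) ?_
    ((measurable_shellFun hξ hg R).comp measurable_prodMk_left) ?_
  · exact ((measure_mono fun z hz => hz.2).trans_lt (hfin R).lt_top).ne
  · refine ((lintegral_mono fun ω => uniqueIn_le_one (ξ := ξ) (X := X) D n k ω).trans_lt ?_).ne
    simp
  · intro z hz
    by_contra hn
    exact hz (if_neg hn)

end Nearest

/-! ### The process seen beyond its point of least level. -/

section Palm

variable {Ω E : Type*} [MeasurableSpace Ω] [MeasurableSpace E] {X : ℕ → Ω → E} {Λ : Measure E}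
  {μ : Measure Ω} [IsProbabilityMeasure μ] {ξ : E → ℝ} {g : ℝ → ℝ → ℝ≥0∞}

/-- Refining the grid in the discretized identity. The cutoff `R` makes the sum over points finite
and gives the intensity integral the integrable bound `1` on `{ξ ≤ R}`, so both depend on the
threshold continuously from the right. -/
lemma IsPoissonProcess.lintegral_nearest_shell [SigmaFinite Λ]
    (hX : IsPoissonProcess X Λ μ) (hξ : Measurable ξ) (hξ0 : ∀ z, 0 ≤ ξ z)
    (hfin : ∀ R, Λ {z | ξ z ≤ R} ≠ ∞) (hnull : ∀ c, Λ {z | ξ z = c} = 0)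
    (hg : Measurable (Function.uncurry g))
    (hc : ∀ x y, 0 < x → 0 < y → ContinuousAt (fun t => g t y) x)
    {ι : Ω → ℕ} (hmin : ∀ᵐ ω ∂μ, ∀ j, ξ (X (ι ω) ω) ≤ ξ (X j ω))
    {D : Set E} (hD : MeasurableSet D) (R : ℝ) :
    ∫⁻ ω, D.indicator 1 (X (ι ω) ω) * eexp (∑' i, shellFun ξ g (ξ (X (ι ω) ω)) R (X i ω)) ∂μ =
      ∫⁻ ω, D.indicator 1 (X (ι ω) ω) *
        eexp (∫⁻ z, (1 - eexp (shellFun ξ g (ξ (X (ι ω) ω)) R z)) ∂Λ) ∂μ := by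
  have hU : ∀ n k, Measurable (uniqueIn ξ X D n k) := hX.measurable_uniqueIn hξ hD
  have hs : ∀ t, Measurable fun ω => ∑' i, shellFun ξ g t R (X i ω) := fun t =>
    Measurable.tsum fun i => ((measurable_shellFun hξ hg R).comp measurable_prodMk_left).comp
      (hX.measurable i)
  have hreg := hX.ae_isRegularAt hξ hξ0 hfin hnull
  -- One limit theorem for a general factor `V`, used twice: with the random exponential of the sum,
  -- and with its deterministic average.
  have hlim : ∀ V : ℝ → Ω → ℝ≥0∞, (∀ t, Measurable (V t)) → (∀ t ω, V t ω ≤ 1) →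
      (∀ ω, IsRegularAt ξ X ω → (∀ j, ξ (X (ι ω) ω) ≤ ξ (X j ω)) →
        Tendsto (fun n => V (gridPoint n (cell n (ξ (X (ι ω) ω)))) ω) atTop
          (𝓝 (V (ξ (X (ι ω) ω)) ω))) →
      Tendsto (fun n => ∑' k, ∫⁻ ω, uniqueIn ξ X D n k ω * V (gridPoint n k) ω ∂μ) atTop
        (𝓝 (∫⁻ ω, D.indicator 1 (X (ι ω) ω) * V (ξ (X (ι ω) ω)) ω ∂μ)) := by
    intro V hV hV1 hVlim
    have hm : ∀ n k, Measurable fun ω => uniqueIn ξ X D n k ω * V (gridPoint n k) ω :=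
      fun n k => (hU n k).mul (hV _)
    have hswap : ∀ n, ∑' k, ∫⁻ ω, uniqueIn ξ X D n k ω * V (gridPoint n k) ω ∂μ =
        ∫⁻ ω, ∑' k, uniqueIn ξ X D n k ω * V (gridPoint n k) ω ∂μ := fun n =>
      (lintegral_tsum fun k => (hm n k).aemeasurable).symm
    simp_rw [hswap]
    have hsingle : ∀ n, ∀ ω, (∀ j, ξ (X (ι ω) ω) ≤ ξ (X j ω)) →
        ∑' k, uniqueIn ξ X D n k ω * V (gridPoint n k) ω =
          uniqueIn ξ X D n (cell n (ξ (X (ι ω) ω))) ω *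
            V (gridPoint n (cell n (ξ (X (ι ω) ω)))) ω := fun n ω hω =>
      tsum_eq_single _ fun k hk => by rw [uniqueIn_eq_zero hω hk, zero_mul]
    refine tendsto_lintegral_of_dominated_convergence (fun _ => 1)
      (fun n => Measurable.tsum fun k => hm n k) (fun n => ?_) (by simp) ?_
    · filter_upwards [hmin] with ω hω
      rw [hsingle n ω hω]
      exact mul_le_one' (uniqueIn_le_one _ _ _ _) (hV1 _ _)
    · filter_upwards [hmin, hreg] with ω hω hr
      simp_rw [fun n => hsingle n ω hω]
      have h1 : Tendsto (fun n => D.indicator 1 (X (ι ω) ω) *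
          V (gridPoint n (cell n (ξ (X (ι ω) ω)))) ω) atTop
          (𝓝 (D.indicator 1 (X (ι ω) ω) * V (ξ (X (ι ω) ω)) ω)) := by
        refine ENNReal.Tendsto.const_mul (hVlim ω hr hω) (Or.inr ?_)
        by_cases hD : X (ι ω) ω ∈ D <;> simp [hD]
      refine h1.congr' ?_
      filter_upwards [hr.eventually_uniqueIn D hω] with n hn
      rw [hn]
  refine tendsto_nhds_unique (hlim (fun t ω => eexp (∑' i, shellFun ξ g t R (X i ω)))
    (fun t => measurable_eexp.comp (hs t)) (fun t ω => eexp_le_one _) ?_) ?_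
  · intro ω hr hω
    refine (continuous_eexp.tendsto _).comp ?_
    have hsum : ∀ t, ∑' i, shellFun ξ g t R (X i ω) =
        ∑ i ∈ (hr.finite R).toFinset, shellFun ξ g t R (X i ω) := fun t =>
      tsum_eq_sum fun i hi => if_neg fun h => hi (by simpa using h.2)
    simp_rw [hsum]
    exact tendsto_finsetSum _ fun i _ => tendsto_shellFun hc R (hr.pos _) (tendsto_gridPoint_cell _)
      (fun n => le_gridPoint_cell n _) _
  · simp_rw [hX.lintegral_uniqueIn_mul hξ hfin hg hD]
    refine hlim (fun t _ => eexp (∫⁻ z, (1 - eexp (shellFun ξ g t R z)) ∂Λ))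
      (fun t => measurable_const) (fun t ω => eexp_le_one _) ?_
    intro ω hr hω
    refine (continuous_eexp.tendsto _).comp ?_
    refine tendsto_lintegral_of_dominated_convergence ({z | ξ z ≤ R}.indicator 1)
      (fun n => measurable_const.sub (measurable_eexp.comp
        ((measurable_shellFun hξ hg R).comp measurable_prodMk_left)))
      (fun n => ae_of_all _ fun z => ?_) ?_ (ae_of_all _ fun z => ?_)
    · by_cases hz : ξ z ≤ R
      · simp [hz]
      · simp [shellFun, hz]
    · rw [lintegral_indicator_one (measurableSet_le hξ measurable_const)]
      exact hfin R
    · exact ENNReal.Tendsto.sub tendsto_const_nhds ((continuous_eexp.tendsto _).comp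
        (tendsto_shellFun hc R (hr.pos _) (tendsto_gridPoint_cell _)
          (fun n => le_gridPoint_cell n _) _)) (Or.inl ENNReal.one_ne_top)

/-- The cutoff is removed along integers: both exponents increase to their limits, and the
integrands stay below one. -/
lemma IsPoissonProcess.lintegral_nearest_indicator [SigmaFinite Λ]
    (hX : IsPoissonProcess X Λ μ) (hξ : Measurable ξ) (hξ0 : ∀ z, 0 ≤ ξ z)
    (hfin : ∀ R, Λ {z | ξ z ≤ R} ≠ ∞) (hnull : ∀ c, Λ {z | ξ z = c} = 0)
    (hg : Measurable (Function.uncurry g))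
    (hc : ∀ x y, 0 < x → 0 < y → ContinuousAt (fun t => g t y) x)
    {ι : Ω → ℕ} (hι : Measurable ι) (hmin : ∀ᵐ ω ∂μ, ∀ j, ξ (X (ι ω) ω) ≤ ξ (X j ω))
    {D : Set E} (hD : MeasurableSet D) :
    ∫⁻ ω, D.indicator 1 (X (ι ω) ω) * eexp (∑' i, tailFun ξ g (ξ (X (ι ω) ω)) (X i ω)) ∂μ =
      ∫⁻ ω, D.indicator 1 (X (ι ω) ω) *
        eexp (∫⁻ z, (1 - eexp (tailFun ξ g (ξ (X (ι ω) ω)) z)) ∂Λ) ∂μ := by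
  have hZ : Measurable fun ω => X (ι ω) ω := measurable_eval_index hX.measurable hι
  have hDm : Measurable fun ω => (D.indicator 1 (X (ι ω) ω) : ℝ≥0∞) :=
    (measurable_one.indicator hD).comp hZ
  have hD1 : ∀ ω, (D.indicator 1 (X (ι ω) ω) : ℝ≥0∞) ≤ 1 := fun ω =>
    indicator_le_self' (fun _ _ => zero_le) _
  have hlim : ∀ (T : ℕ → Ω → ℝ≥0∞) (T' : Ω → ℝ≥0∞), (∀ n, Measurable (T n)) →
      (∀ ω, Tendsto (fun n => T n ω) atTop (𝓝 (T' ω))) →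
      Tendsto (fun n => ∫⁻ ω, D.indicator 1 (X (ι ω) ω) * eexp (T n ω) ∂μ) atTop
        (𝓝 (∫⁻ ω, D.indicator 1 (X (ι ω) ω) * eexp (T' ω) ∂μ)) := by
    intro T T' hT hTT'
    refine tendsto_lintegral_of_dominated_convergence (fun _ => 1)
      (fun n => hDm.mul (measurable_eexp.comp (hT n)))
      (fun n => ae_of_all _ fun ω => mul_le_one' (hD1 ω) (eexp_le_one _)) (by simp)
      (ae_of_all _ fun ω => ?_)
    exact ENNReal.Tendsto.const_mul ((continuous_eexp.tendsto _).comp (hTT' ω))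
      (Or.inr ((hD1 ω).trans_lt ENNReal.one_lt_top).ne)
  refine tendsto_nhds_unique
    (hlim (fun n ω => ∑' i, shellFun ξ g (ξ (X (ι ω) ω)) n (X i ω)) _ (fun n => ?_) fun ω => ?_) ?_
  · exact Measurable.tsum fun i => (measurable_shellFun hξ hg n).comp
      ((hξ.comp hZ).prodMk (hX.measurable i))
  · exact tendsto_tsum_of_monotone (fun i => monotone_shellFun _ _ _ _)
      fun i => tendsto_shellFun_atTop _ _ _ _
  · simp_rw [fun n : ℕ => hX.lintegral_nearest_shell hξ hξ0 hfin hnull hg hc hmin hD n]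
    refine hlim (fun n ω => ∫⁻ z, (1 - eexp (shellFun ξ g (ξ (X (ι ω) ω)) n z)) ∂Λ) _
      (fun n => ?_) fun ω => ?_
    · have h1 : Measurable fun p : ℝ × E => 1 - eexp (shellFun ξ g p.1 n p.2) :=
        measurable_const.sub (measurable_eexp.comp (measurable_shellFun hξ hg n))
      exact h1.lintegral_prod_right'.comp (hξ.comp hZ)
    · refine lintegral_tendsto_of_tendsto_of_monotone
        (fun n => (measurable_const.sub (measurable_eexp.comp
          ((measurable_shellFun hξ hg n).comp measurable_prodMk_left))).aemeasurable)
        (ae_of_all _ fun z m n hmn => tsub_le_tsub_left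
          (eexp_antitone (monotone_shellFun _ _ _ _ hmn)) _) (ae_of_all _ fun z => ?_)
      exact ENNReal.Tendsto.sub tendsto_const_nhds ((continuous_eexp.tendsto _).comp
        (tendsto_shellFun_atTop _ _ _ _)) (Or.inl ENNReal.one_ne_top)

/-- Given the point with the least level `x`, the points with a larger level form a Poisson
process with the intensity measure restricted to `{ξ > x}`: statement for Laplace functionals. -/
lemma IsPoissonProcess.lintegral_nearest [SigmaFinite Λ]
    (hX : IsPoissonProcess X Λ μ) (hξ : Measurable ξ) (hξ0 : ∀ z, 0 ≤ ξ z)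
    (hfin : ∀ R, Λ {z | ξ z ≤ R} ≠ ∞) (hnull : ∀ c, Λ {z | ξ z = c} = 0)
    (hg : Measurable (Function.uncurry g))
    (hc : ∀ x y, 0 < x → 0 < y → ContinuousAt (fun t => g t y) x)
    {ι : Ω → ℕ} (hι : Measurable ι) (hmin : ∀ᵐ ω ∂μ, ∀ j, ξ (X (ι ω) ω) ≤ ξ (X j ω))
    {f : E → ℝ≥0∞} (hf : Measurable f) :
    ∫⁻ ω, f (X (ι ω) ω) * eexp (∑' i, tailFun ξ g (ξ (X (ι ω) ω)) (X i ω)) ∂μ =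
      ∫⁻ ω, f (X (ι ω) ω) * eexp (∫⁻ z, (1 - eexp (tailFun ξ g (ξ (X (ι ω) ω)) z)) ∂Λ) ∂μ := by
  have hZ : Measurable fun ω => X (ι ω) ω := measurable_eval_index hX.measurable hι
  have hY₁ : Measurable fun ω => eexp (∑' i, tailFun ξ g (ξ (X (ι ω) ω)) (X i ω)) :=
    measurable_eexp.comp (Measurable.tsum fun i => (measurable_tailFun hξ hg).comp
      ((hξ.comp hZ).prodMk (hX.measurable i)))
  have h1 : Measurable fun p : ℝ × E => 1 - eexp (tailFun ξ g p.1 p.2) :=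
    measurable_const.sub (measurable_eexp.comp (measurable_tailFun hξ hg))
  have hY₂ : Measurable fun ω => eexp (∫⁻ z, (1 - eexp (tailFun ξ g (ξ (X (ι ω) ω)) z)) ∂Λ) :=
    measurable_eexp.comp (h1.lintegral_prod_right'.comp (hξ.comp hZ))
  -- Both sides are integrals of `f` against the law of the nearest point weighted by a density. Two
  -- such measures agree once they agree on sets, which is the indicator case.
  have key : ∀ {Y : Ω → ℝ≥0∞}, Measurable Y → ∀ {u : E → ℝ≥0∞}, Measurable u →
      ∫⁻ z, u z ∂((μ.withDensity Y).map fun ω => X (ι ω) ω) = ∫⁻ ω, u (X (ι ω) ω) * Y ω ∂μ := by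
    intro Y hY u hu
    have huZ : Measurable fun ω => u (X (ι ω) ω) := hu.comp hZ
    rw [lintegral_map hu hZ, lintegral_withDensity_eq_lintegral_mul _ hY huZ]
    exact lintegral_congr fun ω => mul_comm _ _
  rw [← key hY₁ hf, ← key hY₂ hf]
  congr 1
  ext D hD
  rw [← lintegral_indicator_one hD, ← lintegral_indicator_one hD, key hY₁ (measurable_one.indicator hD),
    key hY₂ (measurable_one.indicator hD)]
  exact hX.lintegral_nearest_indicator hξ hξ0 hfin hnull hg hc hι hmin hD

end Palm

/-! ### Laplace transform and tail of the exponential law. -/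

section Exponential

/-- The integrand times the density of rate `1` is `1 / (1 + s)` times the density of rate `1 + s`.
-/
lemma lintegral_expMeasure_eexp {s : ℝ} (hs : 0 ≤ s) :
    ∫⁻ x, eexp (ENNReal.ofReal (x * s)) ∂(expMeasure 1) = ENNReal.ofReal (1 / (1 + s)) := by
  have hs1 : 0 < 1 + s := by linarith
  have hm : Measurable fun x : ℝ => eexp (ENNReal.ofReal (x * s)) := by fun_prop
  have hd : expMeasure 1 = volume.withDensity (exponentialPDF 1) := rfl
  have hp : ∀ r, Measurable (exponentialPDF r) := fun r =>
    (measurable_exponentialPDFReal r).ennreal_ofReal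
  rw [hd, lintegral_withDensity_eq_lintegral_mul _ (hp 1) hm]
  have : ∀ x, (exponentialPDF 1 * fun x => eexp (ENNReal.ofReal (x * s))) x =
      ENNReal.ofReal (1 / (1 + s)) * exponentialPDF (1 + s) x := by
    intro x
    rw [Pi.mul_apply]
    rcases lt_or_ge x 0 with hx | hx
    · simp [exponentialPDF_of_neg hx]
    · rw [exponentialPDF_of_nonneg hx, exponentialPDF_of_nonneg hx, eexp_ofReal (mul_nonneg hx hs),
        ← ENNReal.ofReal_mul (by positivity), ← ENNReal.ofReal_mul (by positivity), mul_assoc,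
        ← Real.exp_add, ← mul_assoc, one_div_mul_cancel hs1.ne', one_mul, one_mul]
      ring_nf
  simp_rw [this]
  rw [lintegral_const_mul _ (hp _), lintegral_exponentialPDF_eq_one hs1, mul_one]

lemma expMeasure_lt_ofReal (t : ℝ≥0∞) : expMeasure 1 {x | t < ENNReal.ofReal x} = eexp t := by
  have : IsProbabilityMeasure (expMeasure 1) := isProbabilityMeasure_expMeasure one_pos
  induction t using ENNReal.recTopCoe with
  | top => simp
  | coe t =>
    have h1 : {x : ℝ | (t : ℝ≥0∞) < ENNReal.ofReal x} = (Iic (t : ℝ))ᶜ := by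
      ext x
      rw [mem_ofPred_eq, ← ENNReal.ofReal_coe_nnreal, mem_compl_iff, mem_Iic, not_le]
      exact ENNReal.ofReal_lt_ofReal_iff_of_nonneg t.coe_nonneg
    have h2 := cdf_expMeasure_eq one_pos (t : ℝ)
    rw [if_pos t.coe_nonneg, one_mul] at h2
    rw [h1, prob_compl_eq_one_sub measurableSet_Iic, ← ofReal_cdf, h2, ← ENNReal.ofReal_coe_nnreal,
      eexp_ofReal t.coe_nonneg, ← ENNReal.ofReal_one, ← ENNReal.ofReal_sub _
        (by simp), sub_sub_cancel]

end Exponential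

/-! ### Freezing one of two independent variables. -/

section Independence

variable {Ω α β : Type*} [MeasurableSpace Ω] [MeasurableSpace α] [MeasurableSpace β] {μ : Measure Ω}
  [IsProbabilityMeasure μ]

/-- Two independent random variables can be sampled on two copies of the probability space. -/
lemma measure_eq_lintegral_of_indepFun {U : Ω → α} {V : Ω → β} (hU : Measurable U)
    (hV : Measurable V) (h : IndepFun U V μ) {A : Set (α × β)} (hA : MeasurableSet A) :
    μ {ω | (U ω, V ω) ∈ A} = ∫⁻ ω, μ {ω' | (U ω, V ω') ∈ A} ∂μ := by
  have hU1 : IsProbabilityMeasure (μ.map U) := Measure.isProbabilityMeasure_map hU.aemeasurable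
  have hV1 : IsProbabilityMeasure (μ.map V) := Measure.isProbabilityMeasure_map hV.aemeasurable
  have h1 := (indepFun_iff_map_prod_eq_prod_map_map hU.aemeasurable hV.aemeasurable).1 h
  calc μ {ω | (U ω, V ω) ∈ A} = μ.map (fun ω => (U ω, V ω)) A :=
        (Measure.map_apply (hU.prodMk hV) hA).symm
    _ = ∫⁻ u, μ.map V (Prod.mk u ⁻¹' A) ∂(μ.map U) := by rw [h1, Measure.prod_apply hA]
    _ = ∫⁻ ω, μ.map V (Prod.mk (U ω) ⁻¹' A) ∂μ :=
        lintegral_map (measurable_measure_prodMk_left hA) hU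
    _ = _ := lintegral_congr fun ω => Measure.map_apply hV (measurable_prodMk_left hA)

/-- Freeze `T` and use the exponential tail. This is where Rayleigh fading converts coverage into a
Laplace transform. -/
lemma measure_lt_ofReal_of_indepFun {T : Ω → ℝ≥0∞} {H : Ω → ℝ} (hT : Measurable T)
    (hH : Measurable H) (hlaw : HasLaw H (expMeasure 1) μ) (h : IndepFun T H μ) :
    μ {ω | T ω < ENNReal.ofReal (H ω)} = ∫⁻ ω, eexp (T ω) ∂μ := by
  have hm : MeasurableSet {p : ℝ≥0∞ × ℝ | p.1 < ENNReal.ofReal p.2} :=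
    measurableSet_lt measurable_fst measurable_snd.ennreal_ofReal
  have := measure_eq_lintegral_of_indepFun hT hH h hm
  refine this.trans (lintegral_congr fun ω => ?_)
  rw [← expMeasure_lt_ofReal]
  exact hlaw.measure_eq (p := fun x => T ω < ENNReal.ofReal x)
    (measurableSet_lt measurable_const measurable_id.ennreal_ofReal)

end Independence

/-! ### Averaging over fading and gains. -/

section Marks

variable {a b : Fin 4 → ℝ}

/-- Laplace transform at `c` of the product of an exponential fading and an antenna gain. -/
noncomputable def markLaplace (a b : Fin 4 → ℝ) (c : ℝ) : ℝ := ∑ k, b k * (1 / (1 + a k * c))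

/-- Minus the logarithm of the Laplace transform of the marks. -/
noncomputable def markLoss (a b : Fin 4 → ℝ) (c : ℝ) : ℝ≥0∞ :=
  ENNReal.ofReal (-Real.log (markLaplace a b c))

lemma markLaplace_zero (hb1 : ∑ k, b k = 1) : markLaplace a b 0 = 1 := by simp [markLaplace, hb1]

lemma markLoss_zero (hb1 : ∑ k, b k = 1) : markLoss a b 0 = 0 := by
  simp [markLoss, markLaplace_zero hb1]

lemma markLaplace_pos (ha : ∀ k, 0 ≤ a k) (hb : ∀ k, 0 ≤ b k) (hb1 : ∑ k, b k = 1) {c : ℝ}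
    (hc : 0 ≤ c) : 0 < markLaplace a b c := by
  have hpos : ∀ k, 0 < 1 / (1 + a k * c) := fun k => by have := mul_nonneg (ha k) hc; positivity
  obtain ⟨k, hk⟩ : ∃ k, b k ≠ 0 := by
    by_contra! h
    simp [h] at hb1
  exact Finset.sum_pos' (fun k _ => mul_nonneg (hb k) (hpos k).le)
    ⟨k, Finset.mem_univ k, mul_pos (lt_of_le_of_ne (hb k) hk.symm) (hpos k)⟩

lemma one_sub_markLaplace (ha : ∀ k, 0 ≤ a k) (hb1 : ∑ k, b k = 1) {c : ℝ} (hc : 0 ≤ c) :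
    1 - markLaplace a b c = ∑ k, b k * (a k * c / (1 + a k * c)) := by
  have h1 : 1 - markLaplace a b c = ∑ k, b k - markLaplace a b c := by rw [hb1]
  rw [h1, markLaplace, ← Finset.sum_sub_distrib]
  refine Finset.sum_congr rfl fun k _ => ?_
  have : 1 + a k * c ≠ 0 := by have := mul_nonneg (ha k) hc; positivity
  field_simp
  ring

lemma markLaplace_le_one (ha : ∀ k, 0 ≤ a k) (hb : ∀ k, 0 ≤ b k) (hb1 : ∑ k, b k = 1) {c : ℝ}
    (hc : 0 ≤ c) : markLaplace a b c ≤ 1 := by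
  have h : 0 ≤ 1 - markLaplace a b c := by
    rw [one_sub_markLaplace ha hb1 hc]
    refine Finset.sum_nonneg fun k _ => mul_nonneg (hb k) ?_
    have := mul_nonneg (ha k) hc
    positivity
  linarith

lemma eexp_markLoss (ha : ∀ k, 0 ≤ a k) (hb : ∀ k, 0 ≤ b k) (hb1 : ∑ k, b k = 1) {c : ℝ}
    (hc : 0 ≤ c) : eexp (markLoss a b c) = ENNReal.ofReal (markLaplace a b c) := by
  have h0 := markLaplace_pos ha hb hb1 hc
  rw [markLoss, eexp_ofReal, neg_neg, Real.exp_log h0]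
  exact neg_nonneg.2 (Real.log_nonpos h0.le (markLaplace_le_one ha hb hb1 hc))

lemma measurable_markLoss : Measurable (markLoss a b) := by
  unfold markLoss markLaplace
  fun_prop

lemma continuousAt_markLoss (ha : ∀ k, 0 ≤ a k) (hb : ∀ k, 0 ≤ b k) (hb1 : ∑ k, b k = 1) {c : ℝ}
    (hc : 0 ≤ c) : ContinuousAt (markLoss a b) c := by
  refine ENNReal.continuous_ofReal.continuousAt.comp (ContinuousAt.neg (ContinuousAt.log ?_
    (markLaplace_pos ha hb hb1 hc).ne'))
  refine tendsto_finsetSum _ fun k _ => ?_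
  have : 1 + a k * c ≠ 0 := by have := mul_nonneg (ha k) hc; positivity
  exact ContinuousAt.mul continuousAt_const (ContinuousAt.div continuousAt_const (by fun_prop) this)

variable {Ω : Type*} [MeasurableSpace Ω] {μ : Measure Ω} [IsProbabilityMeasure μ]

/-- Integrate the fading first with the gain fixed, then sum over the four gain values. -/
lemma lintegral_eexp_mark (ha : ∀ k, 0 ≤ a k) (hb : ∀ k, 0 ≤ b k) {H Γ : Ω → ℝ}
    (hH : Measurable H) (hΓ : Measurable Γ) (hH_law : HasLaw H (expMeasure 1) μ)
    (hΓ_law : HasLaw Γ (∑ k, ENNReal.ofReal (b k) • Measure.dirac (a k)) μ)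
    (hind : IndepFun H Γ μ) {c : ℝ} (hc : 0 ≤ c) :
    ∫⁻ ω, eexp (ENNReal.ofReal (H ω * Γ ω * c)) ∂μ = ENNReal.ofReal (markLaplace a b c) := by
  have : IsProbabilityMeasure (expMeasure 1) := isProbabilityMeasure_expMeasure one_pos
  have hΓ1 : IsProbabilityMeasure (μ.map Γ) := Measure.isProbabilityMeasure_map hΓ.aemeasurable
  have h1 := (indepFun_iff_map_prod_eq_prod_map_map hH.aemeasurable hΓ.aemeasurable).1 hind
  have hm : Measurable fun p : ℝ × ℝ => eexp (ENNReal.ofReal (p.1 * p.2 * c)) := by fun_prop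
  calc ∫⁻ ω, eexp (ENNReal.ofReal (H ω * Γ ω * c)) ∂μ
      = ∫⁻ p, eexp (ENNReal.ofReal (p.1 * p.2 * c)) ∂(μ.map fun ω => (H ω, Γ ω)) :=
        (lintegral_map hm (hH.prodMk hΓ)).symm
    _ = ∫⁻ y, ∫⁻ x, eexp (ENNReal.ofReal (x * y * c)) ∂(expMeasure 1) ∂(μ.map Γ) := by
        rw [h1, hH_law.map_eq, lintegral_prod_symm _ hm.aemeasurable]
    _ = ∑ k, ENNReal.ofReal (b k) * ENNReal.ofReal (1 / (1 + a k * c)) := by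
        rw [hΓ_law.map_eq, lintegral_finsetSum_measure]
        refine Finset.sum_congr rfl fun k _ => ?_
        rw [lintegral_smul_measure, lintegral_dirac, smul_eq_mul]
        simp_rw [mul_assoc]
        rw [lintegral_expMeasure_eexp (mul_nonneg (ha k) hc)]
    _ = _ := by
        rw [markLaplace, ENNReal.ofReal_sum_of_nonneg]
        · exact Finset.sum_congr rfl fun k _ => (ENNReal.ofReal_mul (hb k)).symm
        · intro k _
          have := mul_nonneg (ha k) hc
          exact mul_nonneg (hb k) (by positivity)

/-- Independence factors the finite partial sums; both sides pass to the limit by continuity of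
`eexp`, even if the sums diverge. -/
lemma lintegral_eexp_tsum_marks (ha : ∀ k, 0 ≤ a k) (hb : ∀ k, 0 ≤ b k) (hb1 : ∑ k, b k = 1)
    {h G : ℕ → Ω → ℝ} (hh : ∀ i, Measurable (h i)) (hG : ∀ i, Measurable (G i))
    (hh_law : ∀ i, HasLaw (h i) (expMeasure 1) μ)
    (hG_law : ∀ i, HasLaw (G i) (∑ k, ENNReal.ofReal (b k) • Measure.dirac (a k)) μ)
    (hhG : ∀ i, IndepFun (h i) (G i) μ) (hmarks : iIndepFun (fun i ω => (h i ω, G i ω)) μ)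
    {c : ℕ → ℝ} (hc : ∀ i, 0 ≤ c i) :
    ∫⁻ ω, eexp (∑' i, ENNReal.ofReal (h i ω * G i ω * c i)) ∂μ = eexp (∑' i, markLoss a b (c i)) := by
  have hm : ∀ i, Measurable fun ω => ENNReal.ofReal (h i ω * G i ω * c i) := fun i => by
    have := hh i
    have := hG i
    fun_prop
  have hind : iIndepFun (fun i ω => eexp (ENNReal.ofReal (h i ω * G i ω * c i))) μ :=
    hmarks.comp (fun i p => eexp (ENNReal.ofReal (p.1 * p.2 * c i))) (fun i => by fun_prop)
  have hL : Tendsto (fun n => ∫⁻ ω, eexp (∑ i ∈ Finset.range n, ENNReal.ofReal (h i ω * G i ω * c i)) ∂μ)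
      atTop (𝓝 (∫⁻ ω, eexp (∑' i, ENNReal.ofReal (h i ω * G i ω * c i)) ∂μ)) := by
    refine tendsto_lintegral_of_dominated_convergence (fun _ => 1)
      (fun n => measurable_eexp.comp (Finset.measurable_fun_sum _ fun i _ => hm i))
      (fun n => ae_of_all _ fun ω => eexp_le_one _) (by simp) (ae_of_all _ fun ω => ?_)
    exact (continuous_eexp.tendsto _).comp (ENNReal.tendsto_nat_tsum _)
  refine tendsto_nhds_unique hL ?_
  have hR : ∀ n, ∫⁻ ω, eexp (∑ i ∈ Finset.range n, ENNReal.ofReal (h i ω * G i ω * c i)) ∂μ =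
      eexp (∑ i ∈ Finset.range n, markLoss a b (c i)) := fun n => by
    simp_rw [eexp_sum]
    rw [lintegral_prod_eq_prod_lintegral_of_indepFun _ _ hind fun i => measurable_eexp.comp (hm i)]
    refine Finset.prod_congr rfl fun i _ => ?_
    rw [lintegral_eexp_mark ha hb (hh i) (hG i) (hh_law i) (hG_law i) (hhG i) (hc i),
      eexp_markLoss ha hb hb1 (hc i)]
  simp_rw [hR]
  exact (continuous_eexp.tendsto _).comp (ENNReal.tendsto_nat_tsum _)

omit [MeasurableSpace Ω] in
lemma measurable_tsum_others {m : MeasurableSpace Ω} {f : ℕ → Ω → ℝ≥0∞} {i₀ : ℕ}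
    (hf : ∀ i, i ≠ i₀ → Measurable (f i)) : Measurable fun ω => ∑' i, if i = i₀ then 0 else f i ω := by
  refine Measurable.tsum fun i => ?_
  by_cases hi : i = i₀
  · simp [hi]
  · simpa only [hi, if_false] using hf i hi

omit [IsProbabilityMeasure μ] in
lemma indepFun_tsum_others {h G : ℕ → Ω → ℝ} (hh : ∀ i, Measurable (h i))
    (hG : ∀ i, Measurable (G i)) (hmarks : iIndepFun (fun i ω => (h i ω, G i ω)) μ) (i₀ : ℕ)
    (c : ℕ → ℝ) :
    IndepFun (fun ω => ∑' i, if i = i₀ then 0 else ENNReal.ofReal (h i ω * G i ω * c i)) (h i₀) μ := by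
  let m : ℕ → MeasurableSpace Ω := fun i =>
    MeasurableSpace.comap (fun ω => (h i ω, G i ω)) inferInstance
  have hle : ∀ i, m i ≤ ‹MeasurableSpace Ω› := fun i => ((hh i).prodMk (hG i)).comap_le
  -- The σ-algebras generated by the marks off `i₀` and by the mark at `i₀` are independent; the sum
  -- is measurable for the former.
  have h1 := indep_iSup_of_disjoint hle hmarks (disjoint_compl_left (a := ({i₀} : Set ℕ)))
  have hmi : ∀ i, Measurable[m i] fun ω => (h i ω, G i ω) := fun i => comap_measurable _
  refine indep_of_indep_of_le_left (indep_of_indep_of_le_right h1 ?_) ?_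
  · refine (Measurable.comap_le ?_).trans (le_iSup₂ (f := fun i (_ : i ∈ ({i₀} : Set ℕ)) => m i) i₀ rfl)
    exact measurable_fst.comp (hmi i₀)
  · refine Measurable.comap_le ?_
    refine measurable_tsum_others fun i hi => ?_
    · have h2 : Measurable fun p : ℝ × ℝ => ENNReal.ofReal (p.1 * p.2 * c i) := by fun_prop
      exact (h2.comp (hmi i)).mono (le_iSup₂ (f := fun i (_ : i ∈ ({i₀}ᶜ : Set ℕ)) => m i) i hi) le_rfl

/-- Coverage probability for fixed received powers `p i`, with serving index `i₀`. -/
lemma measure_coverage_of_powers (ha : ∀ k, 0 ≤ a k) (hb : ∀ k, 0 ≤ b k) (hb1 : ∑ k, b k = 1)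
    {h G : ℕ → Ω → ℝ} (hh : ∀ i, Measurable (h i)) (hG : ∀ i, Measurable (G i))
    (hh_law : ∀ i, HasLaw (h i) (expMeasure 1) μ)
    (hG_law : ∀ i, HasLaw (G i) (∑ k, ENNReal.ofReal (b k) • Measure.dirac (a k)) μ)
    (hhG : ∀ i, IndepFun (h i) (G i) μ) (hmarks : iIndepFun (fun i ω => (h i ω, G i ω)) μ)
    {γ G0 σ2 : ℝ} (hγ : 0 < γ) (hG0 : 0 < G0) {p : ℕ → ℝ} (hp : ∀ i, 0 ≤ p i)
    {i₀ : ℕ} (hp₀ : 0 < p i₀) :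
    μ {ω | ENNReal.ofReal γ < ENNReal.ofReal (G0 * h i₀ ω * p i₀) / (ENNReal.ofReal σ2 +
        ∑' i, if i = i₀ then 0 else ENNReal.ofReal (h i ω * G i ω * p i))} =
      eexp (ENNReal.ofReal (γ / (G0 * p i₀) * σ2)) *
        eexp (∑' i, if i = i₀ then 0 else markLoss a b (γ / (G0 * p i₀) * p i)) := by
  have hq : 0 < G0 * p i₀ := mul_pos hG0 hp₀
  have hr : 0 ≤ γ / (G0 * p i₀) := (div_pos hγ hq).le
  set I : Ω → ℝ≥0∞ := fun ω => ∑' i, if i = i₀ then 0 else ENNReal.ofReal (h i ω * G i ω * p i) with hI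
  have hIm : Measurable I := measurable_tsum_others fun i _ => by
    have := hh i
    have := hG i
    fun_prop
  have hset : {ω | ENNReal.ofReal γ < ENNReal.ofReal (G0 * h i₀ ω * p i₀) / (ENNReal.ofReal σ2 + I ω)}
      = {ω | ENNReal.ofReal (γ / (G0 * p i₀)) * (ENNReal.ofReal σ2 + I ω) < ENNReal.ofReal (h i₀ ω)} := by
    ext ω
    have hq0 : ENNReal.ofReal (G0 * p i₀) ≠ 0 := by simpa using hq
    rw [mem_ofPred_eq, mem_ofPred_eq, show G0 * h i₀ ω * p i₀ = G0 * p i₀ * h i₀ ω by ring,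
      ENNReal.ofReal_mul hq.le, ENNReal.lt_div_iff_mul_lt (Or.inr (by simp)) (Or.inr (by finiteness)),
      ENNReal.ofReal_div_of_pos hq, mul_comm (ENNReal.ofReal (G0 * p i₀)),
      ← ENNReal.div_lt_iff (Or.inl hq0) (Or.inl ENNReal.ofReal_ne_top), div_eq_mul_inv, div_eq_mul_inv]
    ring_nf
  have hind : IndepFun (fun ω => ENNReal.ofReal (γ / (G0 * p i₀)) * (ENNReal.ofReal σ2 + I ω)) (h i₀) μ :=
    (indepFun_tsum_others hh hG hmarks i₀ p).comp
      (φ := fun t => ENNReal.ofReal (γ / (G0 * p i₀)) * (ENNReal.ofReal σ2 + t)) (by fun_prop) measurable_id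
  rw [hset, measure_lt_ofReal_of_indepFun (by fun_prop) (hh i₀) (hh_law i₀) hind]
  simp_rw [mul_add, eexp_add, ← ENNReal.ofReal_mul hr]
  rw [lintegral_const_mul _ (by fun_prop)]
  congr 1
  -- The serving link gets coefficient `0`, where the mark loss vanishes, so the sum can run over
  -- all indices.
  have hc : ∀ i, 0 ≤ if i = i₀ then 0 else γ / (G0 * p i₀) * p i := fun i => by
    split_ifs
    · exact le_rfl
    · exact mul_nonneg hr (hp i)
  have hL := lintegral_eexp_tsum_marks ha hb hb1 hh hG hh_law hG_law hhG hmarks hc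
  have e1 : ∀ ω, ENNReal.ofReal (γ / (G0 * p i₀)) * I ω = ∑' i, ENNReal.ofReal (h i ω * G i ω *
      if i = i₀ then 0 else γ / (G0 * p i₀) * p i) := fun ω => by
    rw [hI, ← ENNReal.tsum_mul_left]
    refine tsum_congr fun i => ?_
    split_ifs
    · simp
    · rw [← ENNReal.ofReal_mul hr]
      congr 1; ring
  have e2 : ∀ i, markLoss a b (if i = i₀ then 0 else γ / (G0 * p i₀) * p i) =
      if i = i₀ then 0 else markLoss a b (γ / (G0 * p i₀) * p i) := fun i => by
    split_ifs
    · exact markLoss_zero hb1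
    · rfl
  simp_rw [e1, hL, e2]

end Marks

/-! ### Geometry of the path-loss map. -/

section PathLoss

variable {d K P : ℝ} {α : Visibility → ℝ}

instance : Finite Visibility :=
  Finite.of_injective (fun v : Visibility => match v with | .los => true | .nlos => false) (by
    rintro (_ | _) (_ | _) h <;> simp_all)

lemma measurable_visibility (d : ℝ) : Measurable (visibility d) :=
  Measurable.ite (measurableSet_le measurable_norm measurable_const) measurable_const measurable_const

lemma measurable_pathLoss (d K P : ℝ) (α : Visibility → ℝ) : Measurable (pathLoss d K P α) :=
  (measurable_norm.pow ((measurable_from_top (f := α)).comp (measurable_visibility d))).div_const _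

lemma measurable_rxPower (d K P : ℝ) (α : Visibility → ℝ) : Measurable (rxPower d K P α) :=
  (measurable_norm.pow ((measurable_from_top (f := α)).comp (measurable_visibility d)).neg).const_mul _

lemma pathLoss_nonneg (hK : 0 < K) (hP : 0 < P) (z : Plane) : 0 ≤ pathLoss d K P α z := by
  unfold pathLoss; positivity

lemma rxPower_eq_inv (z : Plane) : rxPower d K P α z = (pathLoss d K P α z)⁻¹ := by
  rw [rxPower, pathLoss, Real.rpow_neg (norm_nonneg z), inv_div, div_eq_mul_inv]

lemma norm_eq_of_pathLoss (hK : 0 < K) (hP : 0 < P) (hα : ∀ v, 0 < α v) (z : Plane) :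
    ‖z‖ = (pathLoss d K P α z * (K * P)) ^ (α (visibility d z))⁻¹ := by
  rw [pathLoss, div_mul_cancel₀ _ (mul_pos hK hP).ne', Real.rpow_rpow_inv (norm_nonneg z) (hα _).ne']

/-- In either visibility state the level bounds the norm, so the larger of the two radii gives an
enclosing ball. -/
lemma volume_pathLoss_le (hK : 0 < K) (hP : 0 < P) (hα : ∀ v, 0 < α v) (R : ℝ) :
    (volume : Measure Plane) {z | pathLoss d K P α z ≤ R} ≠ ∞ := by
  refine ((measure_mono (t := Metric.closedBall 0 (max ((R * (K * P)) ^ (α .los)⁻¹)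
    ((R * (K * P)) ^ (α .nlos)⁻¹))) fun z hz => ?_).trans_lt measure_closedBall_lt_top).ne
  have hz' : pathLoss d K P α z ≤ R := hz
  have h0 := pathLoss_nonneg (d := d) (α := α) hK hP z
  have h1 : ‖z‖ ≤ (R * (K * P)) ^ (α (visibility d z))⁻¹ := by
    rw [norm_eq_of_pathLoss (d := d) hK hP hα z]
    exact Real.rpow_le_rpow (by positivity) (by gcongr) (inv_nonneg.2 (hα _).le)
  rw [mem_closedBall_zero_iff]
  cases hv : visibility d z <;> rw [hv] at h1
  · exact h1.trans (le_max_left _ _)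
  · exact h1.trans (le_max_right _ _)

/-- A level set lies in the union of two spheres, one per visibility state. -/
lemma volume_pathLoss_eq (hK : 0 < K) (hP : 0 < P) (hα : ∀ v, 0 < α v) (c : ℝ) :
    (volume : Measure Plane) {z | pathLoss d K P α z = c} = 0 := by
  refine measure_mono_null (t := Metric.sphere 0 ((c * (K * P)) ^ (α .los)⁻¹) ∪
    Metric.sphere 0 ((c * (K * P)) ^ (α .nlos)⁻¹)) (fun z hz => ?_)
    (measure_union_null (Measure.addHaar_sphere _ _ _) (Measure.addHaar_sphere _ _ _))
  have hz' : pathLoss d K P α z = c := hz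
  have h1 := norm_eq_of_pathLoss (d := d) hK hP hα z
  rw [hz'] at h1
  rw [mem_union, mem_sphere_zero_iff_norm, mem_sphere_zero_iff_norm]
  cases hv : visibility d z <;> rw [hv] at h1
  · exact Or.inl h1
  · exact Or.inr h1

instance sigmaFinite_ofReal_smul {E : Type*} [MeasurableSpace E] (ν : Measure E) [SigmaFinite ν]
    (r : ℝ) : SigmaFinite (ENNReal.ofReal r • ν) :=
  inferInstanceAs (SigmaFinite (r.toNNReal • ν))

lemma setLIntegral_pathLossIntensity (lam d K P : ℝ) (α : Visibility → ℝ) (v : Visibility) (x : ℝ)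
    {f : ℝ → ℝ≥0∞} (hf : Measurable f) :
    ∫⁻ y in Ioi x, f y ∂(pathLossIntensity lam d K P α v) =
      ∫⁻ z in {z | visibility d z = v}, (Ioi x).indicator f (pathLoss d K P α z)
        ∂(ENNReal.ofReal lam • (volume : Measure Plane)) := by
  rw [← lintegral_indicator measurableSet_Ioi, pathLossIntensity,
    lintegral_map (hf.indicator measurableSet_Ioi) (measurable_pathLoss d K P α)]

lemma setLIntegral_pathLossIntensity_add (lam d K P : ℝ) (α : Visibility → ℝ) (v : Visibility)
    (x : ℝ) {f : ℝ → ℝ≥0∞} (hf : Measurable f) :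
    ∫⁻ y in Ioi x, f y ∂(pathLossIntensity lam d K P α v) +
      ∫⁻ y in Ioi x, f y ∂(pathLossIntensity lam d K P α v.other) =
      ∫⁻ z, (Ioi x).indicator f (pathLoss d K P α z)
        ∂(ENNReal.ofReal lam • (volume : Measure Plane)) := by
  rw [setLIntegral_pathLossIntensity _ _ _ _ _ _ _ hf, setLIntegral_pathLossIntensity _ _ _ _ _ _ _ hf]
  have hc : {z | visibility d z = v.other} = {z | visibility d z = v}ᶜ := by
    ext z
    cases v <;> cases hz : visibility d z <;> simp [Visibility.other, hz]
  rw [hc]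
  exact lintegral_add_compl _ (measurable_visibility d (measurableSet_singleton v))

end PathLoss

/-! ### From the mark loss to the integrals of the statement. -/

section GainIntegral

variable {a b : Fin 4 → ℝ} {G0 γ : ℝ}

lemma measurable_gainIntegral (Λ : Measure ℝ) [SFinite Λ] : Measurable (gainIntegral a b G0 γ Λ) := by
  unfold gainIntegral
  refine Finset.measurable_fun_sum _ fun k _ => Measurable.const_mul ?_ _
  have h1 : Measurable fun p : ℝ × ℝ => {p : ℝ × ℝ | p.1 < p.2}.indicator (fun p =>
      ENNReal.ofReal ((a k / G0 * γ * p.1) / (p.2 + a k / G0 * γ * p.1))) p :=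
    Measurable.indicator (by fun_prop) (measurableSet_lt measurable_fst measurable_snd)
  have h2 := h1.lintegral_prod_right' (ν := Λ)
  convert h2 using 2 with x
  rw [← lintegral_indicator measurableSet_Ioi]
  rfl

/-- The interference loss for a serving level `x` and an interferer of level `y`. -/
noncomputable def levelLoss (a b : Fin 4 → ℝ) (G0 γ x y : ℝ) : ℝ≥0∞ :=
  markLoss a b (γ * x / (G0 * y))

lemma measurable_levelLoss : Measurable (Function.uncurry (levelLoss a b G0 γ)) :=
  measurable_markLoss.comp (by fun_prop)

lemma continuousAt_levelLoss (ha : ∀ k, 0 ≤ a k) (hb : ∀ k, 0 ≤ b k) (hb1 : ∑ k, b k = 1)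
    (hG0 : 0 < G0) (hγ : 0 < γ) {x y : ℝ} (hx : 0 < x) (hy : 0 < y) :
    ContinuousAt (fun t => levelLoss a b G0 γ t y) x :=
  ContinuousAt.comp (f := fun t => γ * t / (G0 * y)) (g := markLoss a b)
    (continuousAt_markLoss ha hb hb1 (by positivity)) (by fun_prop)

lemma one_sub_eexp_levelLoss (ha : ∀ k, 0 ≤ a k) (hb : ∀ k, 0 ≤ b k) (hb1 : ∑ k, b k = 1)
    (hG0 : 0 < G0) (hγ : 0 < γ) {x y : ℝ} (hx : 0 ≤ x) (hy : 0 < y) :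
    1 - eexp (levelLoss a b G0 γ x y) = ∑ k, ENNReal.ofReal (b k) *
      ENNReal.ofReal ((a k / G0 * γ * x) / (y + a k / G0 * γ * x)) := by
  have hc : 0 ≤ γ * x / (G0 * y) := by positivity
  have hk : ∀ k, 0 ≤ (a k / G0 * γ * x) / (y + a k / G0 * γ * x) := fun k => by
    have := ha k
    positivity
  rw [levelLoss, eexp_markLoss ha hb hb1 hc, ← ENNReal.ofReal_one,
    ← ENNReal.ofReal_sub _ (markLaplace_pos ha hb hb1 hc).le, one_sub_markLaplace ha hb1 hc]
  simp_rw [← ENNReal.ofReal_mul (hb _)]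
  rw [← ENNReal.ofReal_sum_of_nonneg fun k _ => mul_nonneg (hb k) (hk k)]
  congr 1
  refine Finset.sum_congr rfl fun k _ => ?_
  have h1 : 1 + a k * (γ * x / (G0 * y)) ≠ 0 := by have := ha k; positivity
  have h2 : y + a k / G0 * γ * x ≠ 0 := by have := ha k; positivity
  congr 1
  rw [div_eq_div_iff h1 h2]
  field_simp

/-- The two visibility regions partition the plane, so the sum is one integral, whose integrand is
the one in the Laplace functional. -/
lemma gainIntegral_add (ha : ∀ k, 0 ≤ a k) (hb : ∀ k, 0 ≤ b k) (hb1 : ∑ k, b k = 1)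
    (hG0 : 0 < G0) (hγ : 0 < γ) (lam d K P : ℝ) (α : Visibility → ℝ) (v : Visibility) {x : ℝ}
    (hx : 0 ≤ x) :
    gainIntegral a b G0 γ (pathLossIntensity lam d K P α v) x +
      gainIntegral a b G0 γ (pathLossIntensity lam d K P α v.other) x =
      ∫⁻ z, (1 - eexp (tailFun (pathLoss d K P α) (levelLoss a b G0 γ) x z))
        ∂(ENNReal.ofReal lam • (volume : Measure Plane)) := by
  let f : Fin 4 → ℝ → ℝ≥0∞ := fun k y =>
    ENNReal.ofReal ((a k / G0 * γ * x) / (y + a k / G0 * γ * x))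
  have hf : ∀ k, Measurable (f k) := fun k => by fun_prop
  have hfξ : ∀ k, Measurable fun z => (Ioi x).indicator (f k) (pathLoss d K P α z) := fun k =>
    ((hf k).indicator measurableSet_Ioi).comp (measurable_pathLoss d K P α)
  rw [gainIntegral, gainIntegral, ← Finset.sum_add_distrib]
  simp_rw [← mul_add]
  rw [Finset.sum_congr rfl fun k _ => congrArg (ENNReal.ofReal (b k) * ·)
    (setLIntegral_pathLossIntensity_add lam d K P α v x (hf k))]
  rw [Finset.sum_congr rfl fun k _ => (lintegral_const_mul (ENNReal.ofReal (b k)) (hfξ k)).symm,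
    ← lintegral_finsetSum _ fun k _ => (hfξ k).const_mul _]
  refine lintegral_congr fun z => ?_
  by_cases hz : x < pathLoss d K P α z
  · simp [tailFun, hz, one_sub_eexp_levelLoss ha hb hb1 hG0 hγ hx (hx.trans_lt hz), f]
  · simp [tailFun, hz]

end GainIntegral

/-! ### The serving index: minimality and measurability. -/

section Serving

variable {d K P : ℝ} {α : Visibility → ℝ} {Ω : Type*} {X : ℕ → Ω → Plane} {h G : ℕ → Ω → ℝ}

lemma IsRegularAt.pathLoss_serving_le {ω : Ω} (hr : IsRegularAt (pathLoss d K P α) X ω) (j : ℕ) :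
    pathLoss d K P α (X (serving d K P α X ω) ω) ≤ pathLoss d K P α (X j ω) := by
  have hne : {i | ∀ j, rxPower d K P α (X j ω) ≤ rxPower d K P α (X i ω)}.Nonempty := by
    obtain ⟨i, hi⟩ := hr.exists_forall_le
    refine ⟨i, fun j => ?_⟩
    rw [rxPower_eq_inv, rxPower_eq_inv]
    exact inv_anti₀ (hr.pos i) (hi j)
  have h1 : rxPower d K P α (X j ω) ≤ rxPower d K P α (X (serving d K P α X ω) ω) := Nat.sInf_mem hne j
  rw [rxPower_eq_inv, rxPower_eq_inv] at h1
  exact (inv_le_inv₀ (hr.pos j) (hr.pos _)).1 h1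

variable [MeasurableSpace Ω]

lemma measurable_nat_sInf {p : ℕ → Ω → Prop} (hp : ∀ n, MeasurableSet {ω | p n ω}) :
    Measurable fun ω => sInf {n | p n ω} := by
  refine measurable_to_countable' fun n => ?_
  -- The second piece accounts for the default `sInf ∅ = 0`.
  have : (fun ω => sInf {n | p n ω}) ⁻¹' {n} =
      ({ω | p n ω} ∩ ⋂ m ∈ Iio n, {ω | p m ω}ᶜ) ∪ ({ω | n = 0} ∩ ⋂ m, {ω | p m ω}ᶜ) := by
    ext ω
    simp only [mem_preimage, mem_singleton_iff, mem_union, mem_inter_iff, mem_ofPred_eq, mem_iInter,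
      mem_compl_iff, mem_Iio]
    constructor
    · rintro rfl
      rcases eq_empty_or_nonempty {n | p n ω} with he | hne
      · refine Or.inr ⟨by rw [he, Nat.sInf_empty], fun m hm => ?_⟩
        have : m ∈ {n | p n ω} := hm
        simp [he] at this
      · exact Or.inl ⟨Nat.sInf_mem hne, fun m hm => Nat.notMem_of_lt_sInf hm⟩
    · rintro (⟨h1, h2⟩ | ⟨rfl, h2⟩)
      · refine le_antisymm (Nat.sInf_le h1) (not_lt.1 fun hlt => h2 _ hlt ?_)
        exact Nat.sInf_mem (s := {n | p n ω}) ⟨n, h1⟩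
      · have : {n | p n ω} = ∅ := eq_empty_of_forall_notMem h2
        rw [this, Nat.sInf_empty]
  rw [this]
  refine ((hp n).inter (MeasurableSet.biInter (to_countable _) fun m _ => (hp m).compl)).union
    ((MeasurableSet.const _).inter (MeasurableSet.iInter fun m => (hp m).compl))

lemma measurable_serving (hX : ∀ i, Measurable (X i)) : Measurable (serving d K P α X) :=
  measurable_nat_sInf fun i => by
    simp only [ofPred_forall]
    exact MeasurableSet.iInter fun j => measurableSet_le ((measurable_rxPower d K P α).comp (hX j))
      ((measurable_rxPower d K P α).comp (hX i))

lemma measurable_serving_mark (hX : ∀ i, Measurable (X i)) :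
    Measurable fun ω => (servingPathLoss d K P α X ω, servingVisibility d K P α X ω) :=
  ((measurable_pathLoss d K P α).comp (measurable_eval_index hX (measurable_serving hX))).prodMk
    ((measurable_visibility d).comp (measurable_eval_index hX (measurable_serving hX)))

lemma measurable_sinr {G0 σ2 : ℝ} (hX : ∀ i, Measurable (X i)) (hh : ∀ i, Measurable (h i))
    (hG : ∀ i, Measurable (G i)) : Measurable (sinr d K P α G0 σ2 X h G) := by
  have hs := measurable_serving (d := d) (K := K) (P := P) (α := α) hX
  have h1 : Measurable fun ω => h (serving d K P α X ω) ω := measurable_eval_index hh hs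
  have h2 : Measurable fun ω => rxPower d K P α (X (serving d K P α X ω) ω) :=
    (measurable_rxPower d K P α).comp (measurable_eval_index hX hs)
  have h3 : Measurable (interference d K P α X h G) := by
    refine Measurable.tsum fun i => Measurable.ite (measurableSet_eq_fun measurable_const hs)
      measurable_const ?_
    exact (((hh i).mul (hG i)).mul ((measurable_rxPower d K P α).comp (hX i))).ennreal_ofReal
  exact ((h1.const_mul G0).mul h2).ennreal_ofReal.div (h3.const_add _)

end Serving

/-! ### Coverage for fixed locations, then averaged over them. -/

section Coverage

variable {Ω : Type*} [MeasurableSpace Ω] {μ : Measure Ω} [IsProbabilityMeasure μ]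
  {lam d K P σ2 γ G0 : ℝ} {α : Visibility → ℝ} {a b : Fin 4 → ℝ} {X : ℕ → Ω → Plane}
  {h G : ℕ → Ω → ℝ}

/-- Coverage probability for a fixed configuration of access points. -/
lemma measure_coverage_of_regular (hγ : 0 < γ) (hG0 : 0 < G0)
    (ha : ∀ k, 0 ≤ a k) (hb : ∀ k, 0 ≤ b k) (hb1 : ∑ k, b k = 1)
    (hh : ∀ i, Measurable (h i)) (hG : ∀ i, Measurable (G i))
    (hh_law : ∀ i, HasLaw (h i) (expMeasure 1) μ)
    (hG_law : ∀ i, HasLaw (G i) (∑ k, ENNReal.ofReal (b k) • Measure.dirac (a k)) μ)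
    (hhG : ∀ i, IndepFun (h i) (G i) μ) (hmarks : iIndepFun (fun i ω => (h i ω, G i ω)) μ)
    {ω : Ω} (hr : IsRegularAt (pathLoss d K P α) X ω) :
    μ {ω' | ENNReal.ofReal γ < sinr d K P α G0 σ2 (fun i (_ : Ω) => X i ω) h G ω'} =
      eexp (ENNReal.ofReal (γ * servingPathLoss d K P α X ω * σ2 / G0)) *
        eexp (∑' i, tailFun (pathLoss d K P α) (levelLoss a b G0 γ)
          (servingPathLoss d K P α X ω) (X i ω)) := by
  set i₀ := serving d K P α X ω with hi₀
  have hp : ∀ i, 0 < rxPower d K P α (X i ω) := fun i => by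
    rw [rxPower_eq_inv]; exact inv_pos.2 (hr.pos i)
  have hx : servingPathLoss d K P α X ω = pathLoss d K P α (X i₀ ω) := rfl
  have hq : γ / (G0 * rxPower d K P α (X i₀ ω)) = γ * pathLoss d K P α (X i₀ ω) / G0 := by
    rw [rxPower_eq_inv, div_mul_eq_div_div, div_inv_eq_mul, div_mul_eq_mul_div]
  have key := measure_coverage_of_powers (σ2 := σ2) ha hb hb1 hh hG hh_law hG_law hhG hmarks hγ hG0
    (fun i => (hp i).le) (hp i₀)
  rw [hq] at key
  refine key.trans ?_
  rw [hx]
  congr 2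
  · congr 1; ring
  · refine tsum_congr fun i => ?_
    -- The strict inequality in `tailFun` drops the serving point, and distinct levels keep every
    -- other point.
    by_cases hi : i = i₀
    · simp [tailFun, hi]
    · have hlt : pathLoss d K P α (X i₀ ω) < pathLoss d K P α (X i ω) :=
        lt_of_le_of_ne (hr.pathLoss_serving_le i) fun he => hi (hr.injective he.symm)
      rw [if_neg hi, tailFun, if_pos hlt, levelLoss, rxPower_eq_inv]
      congr 1
      rw [← div_eq_mul_inv, div_div]

/-- The defining identity of the conditional probability, tested on an event of the σ-algebra
generated by the serving level and state. -/
lemma IsPoissonProcess.measure_serving_inter_coverage (hK : 0 < K) (hP : 0 < P)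
    (hα : ∀ v, 0 < α v) (hγ : 0 < γ) (hG0 : 0 < G0)
    (ha : ∀ k, 0 ≤ a k) (hb : ∀ k, 0 ≤ b k) (hb1 : ∑ k, b k = 1)
    (hX : IsPoissonProcess X (ENNReal.ofReal lam • (volume : Measure Plane)) μ)
    (hh : ∀ i, Measurable (h i)) (hG : ∀ i, Measurable (G i))
    (hh_law : ∀ i, HasLaw (h i) (expMeasure 1) μ)
    (hG_law : ∀ i, HasLaw (G i) (∑ k, ENNReal.ofReal (b k) • Measure.dirac (a k)) μ)
    (hhG : ∀ i, IndepFun (h i) (G i) μ) (hmarks : iIndepFun (fun i ω => (h i ω, G i ω)) μ)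
    (hXmarks : IndepFun (fun ω i => X i ω) (fun ω i => (h i ω, G i ω)) μ)
    {S : Set (ℝ × Visibility)} (hS : MeasurableSet S) :
    μ ((fun ω => (servingPathLoss d K P α X ω, servingVisibility d K P α X ω)) ⁻¹' S ∩
        {ω | ENNReal.ofReal γ < sinr d K P α G0 σ2 X h G ω}) =
      ∫⁻ ω in (fun ω => (servingPathLoss d K P α X ω, servingVisibility d K P α X ω)) ⁻¹' S,
        eexp (ENNReal.ofReal (γ * servingPathLoss d K P α X ω * σ2 / G0)
          + gainIntegral a b G0 γ (pathLossIntensity lam d K P α (servingVisibility d K P α X ω))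
              (servingPathLoss d K P α X ω)
          + gainIntegral a b G0 γ
              (pathLossIntensity lam d K P α (servingVisibility d K P α X ω).other)
              (servingPathLoss d K P α X ω)) ∂μ := by
  set ξ := pathLoss d K P α with hξ_def
  have hξ : Measurable ξ := measurable_pathLoss d K P α
  have hξ0 : ∀ z, 0 ≤ ξ z := pathLoss_nonneg hK hP
  set Λ := ENNReal.ofReal lam • (volume : Measure Plane) with hΛ_def
  have hfin : ∀ R, Λ {z | ξ z ≤ R} ≠ ∞ := fun R =>
    ENNReal.mul_ne_top ENNReal.ofReal_ne_top (volume_pathLoss_le hK hP hα R)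
  have hnull : ∀ c, Λ {z | ξ z = c} = 0 := fun c => by
    rw [hΛ_def, Measure.smul_apply, volume_pathLoss_eq hK hP hα c, smul_zero]
  have hreg := hX.ae_isRegularAt hξ hξ0 hfin hnull
  -- The event on the product of location and mark sequences, so that independence allows freezing
  -- the locations.
  let F : Set ((ℕ → Plane) × (ℕ → ℝ × ℝ)) :=
    {p | (servingPathLoss d K P α (fun i s => s i) p.1,
        servingVisibility d K P α (fun i s => s i) p.1) ∈ S} ∩
      {p | ENNReal.ofReal γ < sinr d K P α G0 σ2 (fun i p => p.1 i) (fun i p => (p.2 i).1)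
        (fun i p => (p.2 i).2) p}
  have hF : MeasurableSet F := by
    refine MeasurableSet.inter ?_ (measurableSet_lt measurable_const
      (measurable_sinr (fun i => by fun_prop) (fun i => by fun_prop) (fun i => by fun_prop)))
    exact ((measurable_serving_mark (X := fun i (s : ℕ → Plane) => s i)
      (fun i => measurable_pi_apply i)).comp measurable_fst) hS
  have hF' := measure_eq_lintegral_of_indepFun (measurable_pi_lambda _ fun i => hX.measurable i)
    (measurable_pi_lambda _ fun i => (hh i).prodMk (hG i)) hXmarks hF
  set E := (fun ω => (servingPathLoss d K P α X ω, servingVisibility d K P α X ω)) ⁻¹' S with hE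
  have hEm : MeasurableSet E := measurable_serving_mark hX.measurable hS
  -- The conditioning event and the noise factor depend only on the serving location, so they form
  -- the test function for `lintegral_nearest`.
  let f : Plane → ℝ≥0∞ := ((fun z => (ξ z, visibility d z)) ⁻¹' S).indicator
    fun z => eexp (ENNReal.ofReal (γ * ξ z * σ2 / G0))
  have hf : Measurable f := Measurable.indicator (by fun_prop)
    ((hξ.prodMk (measurable_visibility d)) hS)
  have hfE : ∀ ω, f (X (serving d K P α X ω) ω) =
      E.indicator (fun ω => eexp (ENNReal.ofReal (γ * servingPathLoss d K P α X ω * σ2 / G0))) ω :=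
    fun ω => rfl
  calc μ (E ∩ {ω | ENNReal.ofReal γ < sinr d K P α G0 σ2 X h G ω})
      = ∫⁻ ω, μ {ω' | ((fun i => X i ω), fun i => (h i ω', G i ω')) ∈ F} ∂μ := hF'
    _ = ∫⁻ ω, f (X (serving d K P α X ω) ω) *
          eexp (∑' i, tailFun ξ (levelLoss a b G0 γ) (servingPathLoss d K P α X ω) (X i ω)) ∂μ := by
        refine lintegral_congr_ae ?_
        filter_upwards [hreg] with ω hr
        rw [hfE]
        by_cases hω : ω ∈ E
        · rw [indicator_of_mem hω, ← measure_coverage_of_regular hγ hG0 ha hb hb1 hh hG hh_law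
            hG_law hhG hmarks hr]
          congr 1
          ext ω'
          exact ⟨fun h' => h'.2, fun h' => ⟨hω, h'⟩⟩
        · rw [indicator_of_notMem hω, zero_mul]
          refine measure_mono_null (fun ω' h' => ?_) measure_empty
          exact hω h'.1
    _ = ∫⁻ ω, f (X (serving d K P α X ω) ω) * eexp (∫⁻ z, (1 - eexp (tailFun ξ
          (levelLoss a b G0 γ) (servingPathLoss d K P α X ω) z)) ∂Λ) ∂μ :=
        hX.lintegral_nearest hξ hξ0 hfin hnull measurable_levelLoss
          (fun x y hx hy => continuousAt_levelLoss ha hb hb1 hG0 hγ hx hy)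
          (measurable_serving hX.measurable) (hreg.mono fun ω hr => hr.pathLoss_serving_le) hf
    _ = _ := by
        rw [← lintegral_indicator hEm]
        refine lintegral_congr fun ω => ?_
        rw [hfE]
        by_cases hω : ω ∈ E
        · rw [indicator_of_mem hω, indicator_of_mem hω, add_assoc,
            gainIntegral_add ha hb hb1 hG0 hγ _ _ _ _ _ _
              (show 0 ≤ servingPathLoss d K P α X ω from hξ0 _), eexp_add]
        · rw [indicator_of_notMem hω, indicator_of_notMem hω, zero_mul]

end Coverage

end MmWave

/-! ### The mean measure and the conditional coverage probability. -/

theorem lemma5 {Ω : Type*} [MeasurableSpace Ω] (μ : Measure Ω) [IsProbabilityMeasure μ]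
    -- intensity of the APs, LOS radius, path-loss constant, transmit power,
    -- path-loss exponents, noise power, SINR threshold
    (lam d K P : ℝ) (α : Visibility → ℝ) (σ2 γ : ℝ)
    (hlam : 0 < lam) (hd : 0 ≤ d) (hK : 0 < K) (hP : 0 < P) (hα : ∀ v, 0 < α v)
    (hσ2 : 0 ≤ σ2) (hγ : 0 < γ)
    -- the antenna gain takes the values `a k` with probabilities `b k`; its maximum is `G0`
    (a b : Fin 4 → ℝ) (G0 : ℝ) (ha : ∀ k, 0 ≤ a k) (hb : ∀ k, 0 ≤ b k) (hb1 : ∑ k, b k = 1)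
    (hG0 : IsGreatest (Set.range a) G0) (hG0pos : 0 < G0)
    -- AP locations, fading powers and interferer antenna gains
    (X : ℕ → Ω → Plane) (h G : ℕ → Ω → ℝ)
    (hX : IsPoissonProcess X (ENNReal.ofReal lam • (volume : Measure Plane)) μ)
    (hh : ∀ i, Measurable (h i)) (hG : ∀ i, Measurable (G i))
    (hh_law : ∀ i, HasLaw (h i) (expMeasure 1) μ)
    (hG_law : ∀ i, HasLaw (G i) (∑ k, ENNReal.ofReal (b k) • Measure.dirac (a k)) μ)
    -- fading and gains are independent of each other, across APs, and of the AP locations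
    (hhG : ∀ i, IndepFun (h i) (G i) μ)
    (hmarks : iIndepFun (fun i ω => (h i ω, G i ω)) μ)
    (hXmarks : IndepFun (fun ω i => X i ω) (fun ω i => (h i ω, G i ω)) μ) :
    -- `Λ'_v` is the intensity (mean) measure of the path-loss process of the APs in state `v`
    (∀ (v : Visibility) (A : Set ℝ), MeasurableSet A →
      ∫⁻ ω, (count X {z | visibility d z = v ∧ pathLoss d K P α z ∈ A} ω : ℝ≥0∞) ∂μ =
        pathLossIntensity lam d K P α v A) ∧
    -- SINR coverage probability given the path-loss coordinate `x` and state `v` of the serving AP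
    μ⟦{ω | ENNReal.ofReal γ < sinr d K P α G0 σ2 X h G ω} | MeasurableSpace.comap
        (fun ω => (servingPathLoss d K P α X ω, servingVisibility d K P α X ω)) inferInstance⟧
      =ᵐ[μ] fun ω =>
        let x := servingPathLoss d K P α X ω
        let v := servingVisibility d K P α X ω
        expNeg (ENNReal.ofReal (γ * x * σ2 / G0)
          + gainIntegral a b G0 γ (pathLossIntensity lam d K P α v) x
          + gainIntegral a b G0 γ (pathLossIntensity lam d K P α v.other) x) := by
  refine ⟨fun v A hA => ?_, ?_⟩
  · have hB : MeasurableSet {z | visibility d z = v ∧ pathLoss d K P α z ∈ A} :=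
      (measurable_visibility d (measurableSet_singleton v)).inter (measurable_pathLoss d K P α hA)
    simp_rw [coe_count]
    rw [hX.lintegral_ecount hB, pathLossIntensity, Measure.map_apply (measurable_pathLoss d K P α) hA,
      Measure.restrict_apply (measurable_pathLoss d K P α hA), inter_comm]
    rfl
  · have hT := measurable_serving_mark (d := d) (K := K) (P := P) (α := α) hX.measurable
    have hC : MeasurableSet {ω | ENNReal.ofReal γ < sinr d K P α G0 σ2 X h G ω} :=
      measurableSet_lt measurable_const (measurable_sinr hX.measurable hh hG)
    let Φ : ℝ × Visibility → ℝ≥0∞ := fun p =>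
      eexp (ENNReal.ofReal (γ * p.1 * σ2 / G0)
        + gainIntegral a b G0 γ (pathLossIntensity lam d K P α p.2) p.1
        + gainIntegral a b G0 γ (pathLossIntensity lam d K P α p.2.other) p.1)
    have hsf : ∀ v, SFinite (pathLossIntensity lam d K P α v) := fun v => by
      unfold pathLossIntensity; infer_instance
    have hΦ : Measurable Φ := by
      -- The visibility coordinate is countable, so measurability is checked separately for each
      -- state.
      refine measurable_from_prod_countable_left fun v => measurable_eexp.comp ?_
      refine Measurable.add (Measurable.add (f := fun x => ENNReal.ofReal (γ * x * σ2 / G0))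
        (by fun_prop) ?_) ?_
      · exact measurable_gainIntegral (pathLossIntensity lam d K P α v)
      · exact measurable_gainIntegral (pathLossIntensity lam d K P α v.other)
    have hΦ1 : ∀ p, Φ p ≤ 1 := fun p => eexp_le_one _
    have hg : ∀ ω, expNeg (ENNReal.ofReal (γ * servingPathLoss d K P α X ω * σ2 / G0)
          + gainIntegral a b G0 γ (pathLossIntensity lam d K P α (servingVisibility d K P α X ω))
              (servingPathLoss d K P α X ω)
          + gainIntegral a b G0 γ
              (pathLossIntensity lam d K P α (servingVisibility d K P α X ω).other)
              (servingPathLoss d K P α X ω)) =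
        (Φ (servingPathLoss d K P α X ω, servingVisibility d K P α X ω)).toReal :=
      fun ω => expNeg_eq _
    simp_rw [hg]
    have hΦT : Measurable fun ω => Φ (servingPathLoss d K P α X ω, servingVisibility d K P α X ω) :=
      hΦ.comp hT
    -- Uniqueness of the conditional expectation: the candidate is a measurable function of the
    -- serving mark, bounded by one, with the correct integral over each event `T⁻¹ S`.
    refine (ae_eq_condExp_of_forall_setIntegral_eq hT.comap_le
      ((integrable_const (1 : ℝ)).indicator hC) ?_ ?_ ?_).symm
    · intro s _ _
      refine (Integrable.of_bound hΦT.ennreal_toReal.aestronglyMeasurable 1 (ae_of_all _ fun ω => ?_)).integrableOn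
      rw [Real.norm_of_nonneg ENNReal.toReal_nonneg]
      simpa using ENNReal.toReal_mono ENNReal.one_ne_top (hΦ1 _)
    · rintro _ ⟨S, hS, rfl⟩ _
      have key := hX.measure_serving_inter_coverage (d := d) (σ2 := σ2) hK hP hα hγ hG0pos ha hb hb1 hh hG hh_law
        hG_law hhG hmarks hXmarks hS
      rw [integral_toReal hΦT.aemeasurable
        (ae_of_all _ fun ω => (hΦ1 _).trans_lt ENNReal.one_lt_top), setIntegral_indicator hC,
        setIntegral_const, smul_eq_mul, mul_one, measureReal_def, key]
    · exact ((hΦ.ennreal_toReal).comp (comap_measurable _)).aestronglyMeasurable
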